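/- **Setting.** Let $T>0$, $I=[0,T]$, let $E$ be a finite-dimensional real normed space with norm $|\cdot|$, let $f:I\times E\to E$, $g:I\times E\to L(E,E)$, $\phi:I\times E\times E\to\mathbb R$, $\psi:I\times E\to L(\mathbb R^d,\mathbb R)$, $U\subset E$ and $\xi\in E$. Write $\|u\|_r=(\int_I|u|^r\,dt)^{1/r}$ and $\|x\|_\infty=\sup|x|$. A *process* on $[0,T_1]$ (with $0<T_1\le T$) is a pair $(x,u)$ with $u$ measurable, $x$ absolutely continuous, $x(0)=\xi$ and $\dot x(t)=f(t,x(t))+g(t,x(t))u(t)$ for a.e. $t\in[0,T_1]$; if $T_1$ is not mentioned, $T_1=T$. It is *feasible* if $u(t)\in U$ for a.e. $t\in I$, and *admissible* if moreover $t\mapsto\phi(t,x(t),u(t))$ is integrable on $I$ and $t\mapsto\psi(t,x(t))$ has finite $p$-variation on $I$ for some $p\in[1,2)$. Here the $p$-variation of $y$ is $\bigl(\sup\sum_i|y(t_{i+1})-y(t_i)|^p\bigr)^{1/p}$, the supremum being over all finite dissections $0=t_0<\dots<t_n=T$. $\mathcal U_r$ is the set of measurable $u:I\to E$ with $u(t)\in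 U$ for a.e. $t$ and $\|u\|_r<\infty$. An *observation path* is a continuous function $\eta:I\to\mathbb R^d$ of finite $p$-variation for every $p>2$. The cost of an admissible process is $$A(x,u)=\int_I\phi(t,x(t),u(t))\,dt+\int_I\psi(t,x(t))\,d\eta(t),$$ the second integral being a Young integral, that is, the limit of the sums $\sum_i\psi(\tau_i,x(\tau_i))(\eta(t_{i+1})-\eta(t_i))$, $\tau_i\in[t_i,t_{i+1}]$, as the mesh of the dissection tends to $0$, independently of the choice of the dissections and of the $\tau_i$. **Hypothesis.** There are constants $r>1$, $\kappa>\frac12$, $C_\phi,\delta>0$ and $\alpha,\beta,\gamma,C_\psi,C_s,C_e\ge0$ such that: 1. $f$ and $g$ are continuous; 2. for every $R\ge0$, $\psi$ is Hölder on $I\times\{|x|\le R\}$ (with the metric $\max(|t-s|,|x-y|)$) with exponent $\kappa$ and a constant $K_R\le C_\psi(1+R^\alpha)$; 3. $U$ is closed and convex; 4. $\phi$ is continuous on $I\times E\times U$, convex in $u\in U$, and $\phi(t,x,u)\ge C_\phi(|u|^r-|x|^\delta)$ for all $(t,x,u)\in I\times E\times U$; 5. for every $u\in\mathcal U_r$,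 every $0<T_1\le T$ and every $x$ such that $(x,u)$ is a process on $[0,T_1]$ (a local solution), $\bigl(\int_0^{T_1}|\dot x|^r\,dt\bigr)^{1/r}\le C_s(1+\|u\|_r^\beta)$ and $\sup_{[0,T_1]}|x|\le C_e(1+\|u\|_r^\gamma)$; moreover $\gamma(\alpha+\kappa-\frac12)+\frac\beta2<r$ and $\gamma\delta<r$. **Theorem.** Under this hypothesis, suppose that some admissible process $(x_0,u_0)$ exists. Then for every observation path $\eta$, the cost $A$ is well defined on all admissible processes and has a minimiser $(x_*,u_*)$ among them (Problem VAR has a solution). Further, $\|u_*\|_r<\infty$. -/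

import Mathlib

open MeasureTheory Set
open scoped NNReal ENNReal

namespace VarDA

/-- A finite dissection `0 = t 0 < t 1 < ⋯ < t n = T` of the interval `[0, T]`
(the values `t i` with `i > n` play no role). -/
structure Dissection (T : ℝ) where
  n : ℕ
  t : ℕ → ℝ
  zero : t 0 = 0
  last : t n = T
  lt : ∀ i < n, t i < t (i + 1)

/-- The `p`-variation of `x` on `[0, T]`, as an extended nonnegative real. -/
noncomputable def pVariation {V : Type*} [NormedAddCommGroup V] (p T : ℝ) (x : ℝ → V) : ℝ≥0∞ :=
  (⨆ D : Dissection T,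
    ∑ i ∈ Finset.range D.n, ENNReal.ofReal (‖x (D.t (i + 1)) - x (D.t i)‖ ^ p)) ^ (1 / p)

/-- `J` is the Young integral `∫_0^T x(s) dy(s)`: the limit of the Riemann-Stieltjes sums
`∑ x(τ i) (y(t (i+1)) - y(t i))` as the resolution of the dissection goes to zero, whatever the
dissections and the placement of the points `τ i ∈ [t i, t (i+1)]`. -/
def HasYoungIntegral {V W : Type*} [NormedAddCommGroup V] [NormedSpace ℝ V]
    [NormedAddCommGroup W] [NormedSpace ℝ W] (T : ℝ) (x : ℝ → V →L[ℝ] W) (y : ℝ → V) (J : W) :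
    Prop :=
  ∀ ε > 0, ∃ δ > 0, ∀ D : Dissection T, (∀ i < D.n, D.t (i + 1) - D.t i < δ) →
    ∀ τ : ℕ → ℝ, (∀ i < D.n, τ i ∈ Icc (D.t i) (D.t (i + 1))) →
      ‖(∑ i ∈ Finset.range D.n, x (τ i) (y (D.t (i + 1)) - y (D.t i))) - J‖ < ε

/-- An observation path on `[0, T]`: continuous and of finite `p`-variation for all `p > 2`. -/
structure IsObservationPath {d : ℕ} (T : ℝ) (η : ℝ → EuclideanSpace ℝ (Fin d)) : Prop where
  continuousOn : ContinuousOn η (Icc 0 T)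
  pVariation_lt_top : ∀ p : ℝ, 2 < p → pVariation p T η < ⊤

section Control

variable {E : Type*} [NormedAddCommGroup E] [NormedSpace ℝ E] [MeasurableSpace E]

/-- The `L^r`-norm over `[0, T]`, as an extended nonnegative real. -/
noncomputable def lrNorm (r T : ℝ) (u : ℝ → E) : ℝ≥0∞ :=
  eLpNorm u (ENNReal.ofReal r) (volume.restrict (Icc 0 T))

/-- `(x, u)` is a process on `[0, T]` with initial condition `ξ` for the state equation
`x'(t) = f(t, x(t)) + g(t, x(t)) u(t)`. The control is Lebesgue measurable on `[0, T]`, the state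
is absolutely continuous. -/
structure IsProcess (f : ℝ → E → E) (g : ℝ → E → E →L[ℝ] E) (T : ℝ) (ξ : E) (x u : ℝ → E) :
    Prop where
  measurable : AEMeasurable u (volume.restrict (Icc 0 T))
  absolutelyContinuous : AbsolutelyContinuousOnInterval x 0 T
  initial : x 0 = ξ
  state_eq : ∀ᵐ t ∂(volume.restrict (Icc 0 T)),
    HasDerivAt x (f t (x t) + g t (x t) (u t)) t

/-- A feasible process: the control takes values in the control set `U` almost everywhere. -/
structure IsFeasible (f : ℝ → E → E) (g : ℝ → E → E →L[ℝ] E) (U : Set E) (T : ℝ) (ξ : E)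
    (x u : ℝ → E) : Prop where
  process : IsProcess f g T ξ x u
  mem : ∀ᵐ t ∂(volume.restrict (Icc 0 T)), u t ∈ U

/-- An admissible process: a feasible process with finite costs, that is, the deterministic running
costs are integrable along it, and the stochastic running costs have finite `p`-variation for some
`p < 2` along it. -/
structure IsAdmissible {d : ℕ} (f : ℝ → E → E) (g : ℝ → E → E →L[ℝ] E) (U : Set E)
    (φ : ℝ → E → E → ℝ) (ψ : ℝ → E → EuclideanSpace ℝ (Fin d) →L[ℝ] ℝ) (T : ℝ) (ξ : E)
    (x u : ℝ → E) : Prop where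
  feasible : IsFeasible f g U T ξ x u
  integrable : IntegrableOn (fun t => φ t (x t) (u t)) (Icc 0 T)
  finite_pVariation : ∃ p : ℝ, 1 ≤ p ∧ p < 2 ∧ pVariation p T (fun t => ψ t (x t)) < ⊤

/-- The set `𝒰_r` of measurable controls with values in `U` and finite `L^r`-norm. -/
structure IsControl (U : Set E) (r T : ℝ) (u : ℝ → E) : Prop where
  measurable : AEMeasurable u (volume.restrict (Icc 0 T))
  mem : ∀ᵐ t ∂(volume.restrict (Icc 0 T)), u t ∈ U
  lrNorm_lt_top : lrNorm r T u < ⊤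

/-- The value `a` of the cost functional `A(x, u) = ∫ φ(t, x(t), u(t)) dt + ∫ ψ(t, x(t)) dη(t)`;
the stochastic costs are a Young integral, which is required to exist. -/
def HasCost {d : ℕ} (φ : ℝ → E → E → ℝ) (ψ : ℝ → E → EuclideanSpace ℝ (Fin d) →L[ℝ] ℝ) (T : ℝ)
    (η : ℝ → EuclideanSpace ℝ (Fin d)) (x u : ℝ → E) (a : ℝ) : Prop :=
  IntegrableOn (fun t => φ t (x t) (u t)) (Icc 0 T) ∧
    ∃ J : ℝ, HasYoungIntegral T (fun t => ψ t (x t)) η J ∧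
      a = (∫ t in Icc 0 T, φ t (x t) (u t)) + J

/-- `(x, u)` solves the variational data assimilation problem: it is admissible, the cost functional
is well defined on all admissible processes, and `(x, u)` minimises it among them. -/
def IsMinimiser {d : ℕ} (f : ℝ → E → E) (g : ℝ → E → E →L[ℝ] E) (U : Set E)
    (φ : ℝ → E → E → ℝ) (ψ : ℝ → E → EuclideanSpace ℝ (Fin d) →L[ℝ] ℝ) (T : ℝ) (ξ : E)
    (η : ℝ → EuclideanSpace ℝ (Fin d)) (x u : ℝ → E) : Prop :=
  IsAdmissible f g U φ ψ T ξ x u ∧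
    ∃ a, HasCost φ ψ T η x u a ∧
      ∀ x' u', IsAdmissible f g U φ ψ T ξ x' u' →
        (∃ a', HasCost φ ψ T η x' u' a') ∧ ∀ a', HasCost φ ψ T η x' u' a' → a ≤ a'

/-- The standing hypothesis on the data of the problem, with its constants. -/
structure ExistenceHypothesis {d : ℕ} (f : ℝ → E → E) (g : ℝ → E → E →L[ℝ] E) (U : Set E)
    (φ : ℝ → E → E → ℝ) (ψ : ℝ → E → EuclideanSpace ℝ (Fin d) →L[ℝ] ℝ) (T : ℝ) (ξ : E)
    (r : ℝ) (κ : ℝ≥0) (α β γ δ Cφ Cψ Cs Ce : ℝ) : Prop where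
  continuous_f : ContinuousOn (fun z : ℝ × E => f z.1 z.2) (Icc 0 T ×ˢ univ)
  continuous_g : ContinuousOn (fun z : ℝ × E => g z.1 z.2) (Icc 0 T ×ˢ univ)
  kappa_gt : 1 / 2 < (κ : ℝ)
  alpha_nonneg : 0 ≤ α
  Cpsi_nonneg : 0 ≤ Cψ
  /-- Hölder continuity of `ψ` on `[0, T] × {|x| ≤ R}` with constant `K_R ≤ C_ψ (1 + R ^ α)`. -/
  holder : ∀ R : ℝ, 0 ≤ R → ∃ K : ℝ≥0, (K : ℝ) ≤ Cψ * (1 + R ^ α) ∧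
    HolderOnWith K κ (fun z : ℝ × E => ψ z.1 z.2) (Icc 0 T ×ˢ {x : E | ‖x‖ ≤ R})
  closed : IsClosed U
  convex : Convex ℝ U
  continuous_phi : ContinuousOn (fun z : ℝ × E × E => φ z.1 z.2.1 z.2.2)
    (Icc 0 T ×ˢ (univ ×ˢ U))
  convex_phi : ∀ t ∈ Icc 0 T, ∀ x : E, ConvexOn ℝ U (φ t x)
  Cphi_pos : 0 < Cφ
  delta_pos : 0 < δ
  r_gt : 1 < r
  coercive : ∀ t ∈ Icc 0 T, ∀ x : E, ∀ u ∈ U, Cφ * (‖u‖ ^ r - ‖x‖ ^ δ) ≤ φ t x u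
  Cs_nonneg : 0 ≤ Cs
  Ce_nonneg : 0 ≤ Ce
  beta_nonneg : 0 ≤ β
  gamma_nonneg : 0 ≤ γ
  /-- The nonlinearity estimate, for all local solutions. -/
  nonlinearity : ∀ u, IsControl U r T u → ∀ T₁, 0 < T₁ → T₁ ≤ T → ∀ x, IsProcess f g T₁ ξ x u →
    lrNorm r T₁ (deriv x) ≤ ENNReal.ofReal (Cs * (1 + (lrNorm r T u).toReal ^ β))
  /-- The energy estimate, for all local solutions. -/
  energy : ∀ u, IsControl U r T u → ∀ T₁, 0 < T₁ → T₁ ≤ T → ∀ x, IsProcess f g T₁ ξ x u →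
    ∀ t ∈ Icc 0 T₁, ‖x t‖ ≤ Ce * (1 + (lrNorm r T u).toReal ^ γ)
  exponent : γ * (α + κ - 1 / 2) + β / 2 < r
  exponent_delta : γ * δ < r

end Control

end VarDA

/-! The proof is the direct method, with the Young integral treated as a perturbation of the
coercive running cost.

Coercivity. Along a state whose control has norm N, the path `ψ t (x t)` has increments bounded by
`holderBound` times the power a of normalised arc length of the graph of x, for some a slightly
above 1/2. Interpolating the Hölder exponent κ between a and κ - a lets the speed enter only with
power a and the size of the state with power κ - a. Hence the Young integral differs from `ψ 0 ξ (η
T - η 0)` by at most a constant times a power of 1 + N whose exponent tends to γ(α + κ - 1/2) + β/2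
< r as a decreases to 1/2 (`exists_exponent`, `exists_young_process`). The term Cφ N ^ r absorbs it,
so the cost bounds N (`exists_cost_bound`).

Compactness. Arzelà-Ascoli applies to the triples formed by the state, the primitive of the control
and the primitive of the norm of the control. This takes the place of weak compactness in L^r: the
limit control is the derivative of the limit P of the primitives. The state equation, affine in the
control, passes to the limit at almost every point (`exists_limit_process`).

Passage to the limit in the cost. The Riemann sums of the Young integrals converge uniformly over
states with a common speed bound, so the integrals converge (`tendsto_youngIntegral`). The running
cost is lower semicontinuous: near almost every time it has a convex Lipschitz minorant that is
almost exact at the limit control, Jensen's inequality applies to averages over short intervals, and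
two uses of Fatou's lemma integrate the local bounds (`lintegral_le_liminf_lintegral`). Thus the
cost of the limit is at most the infimum. -/

namespace VarDA
open Filter Topology

/-! ### Discrete Young inequality. -/

section Young

variable {V W : Type*} [NormedAddCommGroup V] [NormedSpace ℝ V]
  [NormedAddCommGroup W] [NormedSpace ℝ W]

/-- The constant of the discrete Young inequality with total exponent `θ > 1`. -/
noncomputable def youngConst (θ : ℝ) : ℝ := 2 / (1 - 2 ^ (1 - θ))

lemma two_rpow_lt_one {θ : ℝ} (hθ : 1 < θ) : (2 : ℝ) ^ (1 - θ) < 1 :=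
  Real.rpow_lt_one_of_one_lt_of_neg one_lt_two (by linarith)

lemma youngConst_pos {θ : ℝ} (hθ : 1 < θ) : 0 < youngConst θ :=
  div_pos two_pos (by linarith [two_rpow_lt_one hθ])

/-- This fixed-point equation closes the bisection: two halves contribute `2 ^ (1 - θ)` times the
constant, and the two cross terms contribute 2. -/
lemma youngConst_eq {θ : ℝ} (hθ : 1 < θ) :
    youngConst θ * 2 ^ (1 - θ) + 2 = youngConst θ := by
  have h : (1 : ℝ) - 2 ^ (1 - θ) ≠ 0 := by linarith [two_rpow_lt_one hθ]
  unfold youngConst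
  field_simp
  ring

/-- Discrete Young inequality, proved by bisecting the control `g`. -/
theorem young_discrete {X : ℕ → V →L[ℝ] W} {y : ℕ → V} {g : ℕ → ℝ} {A a b : ℝ} {N : ℕ}
    (hA : 0 ≤ A) (ha : 0 < a) (hb : 0 < b) (hab : 1 < a + b)
    (hg : ∀ i j, i ≤ j → j ≤ N → g i ≤ g j)
    (hX : ∀ i j, i ≤ j → j ≤ N → ‖X j - X i‖ ≤ A * (g j - g i) ^ a)
    (hy : ∀ i j, i ≤ j → j ≤ N → ‖y j - y i‖ ≤ (g j - g i) ^ b) (m : ℕ) :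
    ∀ i j, i ≤ j → j ≤ N → j - i = m →
      ‖∑ l ∈ Finset.Ico i j, X l (y (l + 1) - y l) - X i (y j - y i)‖ ≤
        A * youngConst (a + b) * (g j - g i) ^ (a + b) := by
  have hK := youngConst_pos hab
  have hprod : ∀ i k l j, i ≤ k → k ≤ l → l ≤ j → j ≤ N →
      ‖(X k - X i) (y j - y l)‖ ≤ A * (g j - g i) ^ (a + b) := by
    intro i k l j hik hkl hlj hj
    have h1 := hg i k hik (by lia)
    have h2 := hg k l hkl (by lia)
    have h3 := hg l j hlj hj
    calc ‖(X k - X i) (y j - y l)‖ ≤ ‖X k - X i‖ * ‖y j - y l‖ :=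
          ContinuousLinearMap.le_opNorm _ _
      _ ≤ (A * (g k - g i) ^ a) * (g j - g l) ^ b := by
          gcongr
          · exact hX i k hik (by lia)
          · exact hy l j hlj hj
      _ ≤ (A * (g j - g i) ^ a) * (g j - g i) ^ b := by
          have : 0 ≤ g k - g i := by linarith
          have : 0 ≤ g j - g l := by linarith
          have : 0 ≤ g j - g i := by linarith
          gcongr <;> linarith
      _ = A * (g j - g i) ^ (a + b) := by
          rw [Real.rpow_add_of_nonneg (by linarith) ha.le hb.le]; ring
  induction m using Nat.strong_induction_on with
  | _ m ih =>
  intro i j hij hj hm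
  have hρ : 0 ≤ g j - g i := by linarith [hg i j hij hj]
  rcases hij.eq_or_lt with rfl | hlt
  · simp only [Finset.Ico_self, Finset.sum_empty, sub_self, map_zero, norm_zero]
    positivity
  -- The index k is the last one below j at which `g` has not passed the midpoint of its range. The
  -- step from k to k + 1 may carry most of the variation, so it is split off, and each remaining
  -- block carries at most half.
  obtain ⟨k, hk1, hk2, hk3, hk4⟩ : ∃ k, i ≤ k ∧ k + 1 ≤ j ∧ g k - g i ≤ (g j - g i) / 2 ∧
      g j - g (k + 1) ≤ (g j - g i) / 2 := by
    classical
    let P : ℕ → Prop := fun k => i ≤ k ∧ k < j ∧ g k - g i ≤ (g j - g i) / 2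
    have hPi : P i := ⟨le_rfl, hlt, by simpa using by linarith⟩
    have hspec := Nat.findGreatest_spec (P := P) hlt.le hPi
    refine ⟨Nat.findGreatest P j, hspec.1, hspec.2.1, hspec.2.2, ?_⟩
    rcases (show Nat.findGreatest P j + 1 ≤ j from hspec.2.1).eq_or_lt with h | h
    · rw [h]; linarith
    · have := Nat.findGreatest_is_greatest (P := P) (Nat.lt_succ_self _) h.le
      have h' : ¬ (g (Nat.findGreatest P j + 1) - g i ≤ (g j - g i) / 2) := fun hc =>
        this ⟨by linarith [hspec.1], h, hc⟩
      linarith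
  have e1 := ih (k - i) (by lia) i k hk1 (by lia) rfl
  have e2 := ih (j - (k + 1)) (by lia) (k + 1) j hk2 hj rfl
  have e3 := hprod i k k (k + 1) hk1 le_rfl (by lia) (by lia)
  have e4 := hprod i (k + 1) (k + 1) j (by lia) le_rfl hk2 hj
  have hsum : ∑ l ∈ Finset.Ico i j, X l (y (l + 1) - y l) - X i (y j - y i) =
      (∑ l ∈ Finset.Ico i k, X l (y (l + 1) - y l) - X i (y k - y i)) +
      (∑ l ∈ Finset.Ico (k + 1) j, X l (y (l + 1) - y l) - X (k + 1) (y j - y (k + 1))) +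
      (X k - X i) (y (k + 1) - y k) + (X (k + 1) - X i) (y j - y (k + 1)) := by
    rw [← Finset.sum_Ico_consecutive _ (show i ≤ k + 1 by lia) hk2,
      Finset.sum_Ico_succ_top hk1]
    simp only [map_sub, sub_apply]
    abel
  have m1 : g i ≤ g k := hg i k hk1 (by lia)
  have m2 : g k ≤ g (k + 1) := hg k (k + 1) (by lia) (by lia)
  have m3 : g (k + 1) ≤ g j := hg (k + 1) j hk2 hj
  have hθ : 0 < a + b := by linarith
  have half : ∀ z, 0 ≤ z → z ≤ (g j - g i) / 2 →
      z ^ (a + b) ≤ 2 ^ (1 - (a + b)) / 2 * (g j - g i) ^ (a + b) := by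
    intro z hz hz'
    calc z ^ (a + b) ≤ ((g j - g i) / 2) ^ (a + b) := Real.rpow_le_rpow hz hz' hθ.le
      _ = _ := by
        rw [Real.div_rpow hρ two_pos.le, Real.rpow_sub two_pos, Real.rpow_one]
        field_simp
  have q1 := half (g k - g i) (by linarith) hk3
  have q2 := half (g j - g (k + 1)) (by linarith) hk4
  have q3 : (g (k + 1) - g i) ^ (a + b) ≤ (g j - g i) ^ (a + b) :=
    Real.rpow_le_rpow (by linarith) (by linarith) hθ.le
  rw [hsum]
  set R := (g j - g i) ^ (a + b)
  set K := youngConst (a + b)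
  have hAK : 0 ≤ A * K := by positivity
  calc _ ≤ _ := norm_add₄_le
    _ ≤ A * K * (2 ^ (1 - (a + b)) / 2 * R) + A * K * (2 ^ (1 - (a + b)) / 2 * R)
          + A * R + A * R := by
        gcongr
        · exact e1.trans (by gcongr)
        · exact e2.trans (by gcongr)
        · exact e3.trans (by gcongr)
    _ = A * (K * 2 ^ (1 - (a + b)) + 2) * R := by ring
    _ = A * K * R := by rw [youngConst_eq hab]

/-! ### Dissections and their refinements. -/

namespace Dissection

variable {T : ℝ}

lemma mono (D : Dissection T) {i j : ℕ} (hij : i ≤ j) (hj : j ≤ D.n) : D.t i ≤ D.t j := by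
  induction j, hij using Nat.le_induction with
  | base => exact le_rfl
  | succ j hij ih => exact (ih (by lia)).trans (D.lt j (by lia)).le

lemma strict (D : Dissection T) {i j : ℕ} (hij : i < j) (hj : j ≤ D.n) : D.t i < D.t j :=
  (D.lt i (by lia)).trans_le (D.mono hij hj)

lemma le_of_t_le (D : Dissection T) {i j : ℕ} (hi : i ≤ D.n) (h : D.t i ≤ D.t j) :
    i ≤ j := by
  by_contra hc
  exact absurd h (not_le.2 (D.strict (not_le.1 hc) hi))

lemma mem_Icc (D : Dissection T) {i : ℕ} (hi : i ≤ D.n) : D.t i ∈ Icc 0 T :=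
  ⟨D.zero ▸ D.mono (Nat.zero_le i) hi, by simpa only [D.last] using D.mono hi le_rfl⟩

/-- The points of a dissection. -/
noncomputable def points (D : Dissection T) : Finset ℝ := (Finset.range (D.n + 1)).image D.t

lemma t_mem_points (D : Dissection T) {i : ℕ} (hi : i ≤ D.n) : D.t i ∈ D.points :=
  Finset.mem_image.2 ⟨i, by simp; lia, rfl⟩

lemma mem_points {D : Dissection T} {x : ℝ} : x ∈ D.points ↔ ∃ i ≤ D.n, D.t i = x := by
  simp only [points, Finset.mem_image, Finset.mem_range, Nat.lt_succ_iff]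

lemma exists_of_finset (F : Finset ℝ) (h0 : 0 ∈ F) (hT : T ∈ F) (hF : ∀ x ∈ F, x ∈ Icc 0 T) :
    ∃ D : Dissection T, ∀ x ∈ F, ∃ i ≤ D.n, D.t i = x := by
  have hcard : 0 < F.card := Finset.card_pos.2 ⟨0, h0⟩
  let e := F.orderIsoOfFin rfl
  let t : ℕ → ℝ := fun i => if h : i < F.card then (e ⟨i, h⟩ : ℝ) else T
  have ht : ∀ i (h : i < F.card), t i = e ⟨i, h⟩ := fun i h => dif_pos h
  refine ⟨⟨F.card - 1, t, ?_, ?_, ?_⟩, ?_⟩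
  · rw [ht 0 hcard]
    refine le_antisymm ?_ (hF _ (e _).2).1
    have h : e ⟨0, hcard⟩ ≤ ⟨0, h0⟩ := by
      rw [← e.le_symm_apply]
      exact Fin.mk_le_of_le_val (Nat.zero_le _)
    exact h
  · rw [ht _ (by lia)]
    refine le_antisymm (hF _ (e _).2).2 ?_
    have h : (⟨T, hT⟩ : F) ≤ e ⟨F.card - 1, by lia⟩ := by
      rw [← e.symm_apply_le]
      exact Fin.le_def.2 (by have := (e.symm ⟨T, hT⟩).2; simp only []; lia)
    exact h
  · intro i hi
    rw [ht i (by lia), ht (i + 1) (by lia)]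
    exact e.strictMono (Fin.mk_lt_mk.2 (Nat.lt_succ_self i))
  · intro x hx
    refine ⟨(e.symm ⟨x, hx⟩ : ℕ), ?_, ?_⟩
    · have := (e.symm ⟨x, hx⟩).2
      simp only []
      lia
    · simp only []
      rw [ht _ (e.symm ⟨x, hx⟩).2]
      simp

/-- Two dissections have a common refinement. -/
lemma exists_common_refinement (D₁ D₂ : Dissection T) :
    ∃ D : Dissection T, (∀ i ≤ D₁.n, ∃ k ≤ D.n, D.t k = D₁.t i) ∧
      ∀ i ≤ D₂.n, ∃ k ≤ D.n, D.t k = D₂.t i := by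
  classical
  obtain ⟨D, hD⟩ := exists_of_finset (T := T) (D₁.points ∪ D₂.points)
    (Finset.mem_union_left _ (by simpa only [D₁.zero] using D₁.t_mem_points (Nat.zero_le _)))
    (Finset.mem_union_left _ (by simpa only [D₁.last] using D₁.t_mem_points le_rfl))
    (by
      intro x hx
      rcases Finset.mem_union.1 hx with h | h
      · obtain ⟨i, hi, rfl⟩ := mem_points.1 h
        exact D₁.mem_Icc hi
      · obtain ⟨i, hi, rfl⟩ := mem_points.1 h
        exact D₂.mem_Icc hi)
  exact ⟨D, fun i hi => hD _ (Finset.mem_union_left _ (D₁.t_mem_points hi)),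
    fun i hi => hD _ (Finset.mem_union_right _ (D₂.t_mem_points hi))⟩

/-- Used to cut a sum over the finer dissection into one block for each interval of the coarser one.
-/
lemma exists_index (D D' : Dissection T) (h : ∀ i ≤ D.n, ∃ k ≤ D'.n, D'.t k = D.t i) :
    ∃ k : ℕ → ℕ, k 0 = 0 ∧ k D.n = D'.n ∧ (∀ i ≤ D.n, k i ≤ D'.n ∧ D'.t (k i) = D.t i) ∧
      ∀ i < D.n, k i ≤ k (i + 1) := by
  choose! k hk using h
  refine ⟨k, ?_, ?_, hk, ?_⟩
  · exact Nat.le_zero.1 (D'.le_of_t_le (hk 0 (Nat.zero_le _)).1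
      (by rw [(hk 0 (Nat.zero_le _)).2, D.zero, D'.zero]))
  · exact le_antisymm (hk _ le_rfl).1 (D'.le_of_t_le le_rfl
      (by rw [(hk _ le_rfl).2, D.last, D'.last]))
  · intro i hi
    refine D'.le_of_t_le (hk i hi.le).1 ?_
    rw [(hk i hi.le).2, (hk (i + 1) hi).2]
    exact (D.lt i hi).le

/-- The dissection of `[0, T]` into `m + 1` intervals of equal length. -/
noncomputable def uniform (hT : 0 < T) (m : ℕ) : Dissection T where
  n := m + 1
  t i := i * (T / (m + 1))
  zero := by simp
  last := by push_cast; field_simp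
  lt i _ := by
    have : 0 < T / (m + 1) := by positivity
    push_cast
    nlinarith

lemma uniform_mesh (hT : 0 < T) (m i : ℕ) :
    (uniform hT m).t (i + 1) - (uniform hT m).t i = T / (m + 1) := by
  simp only [uniform]; push_cast; ring

lemma exists_mesh_lt (hT : 0 < T) {δ : ℝ} (hδ : 0 < δ) :
    ∃ D : Dissection T, ∀ i < D.n, D.t (i + 1) - D.t i < δ := by
  obtain ⟨m, hm⟩ := exists_nat_gt (T / δ)
  refine ⟨uniform hT m, fun i _ => ?_⟩
  rw [uniform_mesh, div_lt_iff₀ (by positivity)]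
  rw [div_lt_iff₀ hδ] at hm
  nlinarith

end Dissection

/-! ### Convergence of tagged sums to the Young integral. -/

/-- The tagged Riemann-Stieltjes sum. -/
noncomputable def youngSum {T : ℝ} (D : Dissection T) (τ : ℕ → ℝ) (x : ℝ → V →L[ℝ] W)
    (y : ℝ → V) : W :=
  ∑ i ∈ Finset.range D.n, x (τ i) (y (D.t (i + 1)) - y (D.t i))

lemma sum_Ico_of_monotone {M : Type*} [AddCommMonoid M] (F : ℕ → M) (k : ℕ → ℕ) (h0 : k 0 = 0)
    (n : ℕ) (hk : ∀ i < n, k i ≤ k (i + 1)) :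
    ∑ i ∈ Finset.range n, ∑ l ∈ Finset.Ico (k i) (k (i + 1)), F l =
      ∑ l ∈ Finset.range (k n), F l := by
  induction n with
  | zero => simp [h0]
  | succ n ih =>
    rw [Finset.sum_range_succ, ih (fun i hi => hk i (by lia)), Finset.range_eq_Ico,
      Finset.range_eq_Ico, Finset.sum_Ico_consecutive _ (Nat.zero_le _) (hk n (by lia))]

/-- Each increment gives up the power θ - 1, bounded by that of the total increment; the remaining
first powers telescope. -/
lemma sum_rpow_sub_le {n : ℕ} {G : ℕ → ℝ} {θ : ℝ} (hθ : 1 < θ)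
    (hG : ∀ i j, i ≤ j → j ≤ n → G i ≤ G j) :
    ∑ i ∈ Finset.range n, (G (i + 1) - G i) ^ θ ≤ (G n - G 0) ^ θ := by
  have h0 : 0 ≤ G n - G 0 := by linarith [hG 0 n (Nat.zero_le _) le_rfl]
  calc ∑ i ∈ Finset.range n, (G (i + 1) - G i) ^ θ
      ≤ ∑ i ∈ Finset.range n, (G (i + 1) - G i) * (G n - G 0) ^ (θ - 1) := by
        refine Finset.sum_le_sum fun i hi => ?_
        have hi := Finset.mem_range.1 hi
        have h1 : 0 ≤ G (i + 1) - G i := by linarith [hG i (i + 1) (by lia) hi]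
        have h2 : G (i + 1) - G i ≤ G n - G 0 := by
          linarith [hG (i + 1) n hi le_rfl, hG 0 i (Nat.zero_le _) hi.le]
        calc (G (i + 1) - G i) ^ θ = (G (i + 1) - G i) * (G (i + 1) - G i) ^ (θ - 1) := by
              rw [← Real.rpow_one_add' h1 (by linarith)]; ring_nf
          _ ≤ _ := by
              gcongr
    _ = (G n - G 0) ^ θ := by
        rw [← Finset.sum_mul, Finset.sum_range_sub, ← Real.rpow_one_add' h0 (by linarith)]
        ring_nf

/-- Comparison of a tagged sum with the left-tagged sum over a refinement. -/
lemma norm_youngSum_refine_sub_le {T : ℝ} {x : ℝ → V →L[ℝ] W} {y : ℝ → V} {w v : ℝ → ℝ}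
    {A a a' b μ : ℝ} (hA : 0 ≤ A) (ha' : 0 < a') (haa : a' < a) (hb : 0 < b) (hab : 1 < a' + b)
    (hw : MonotoneOn w (Icc 0 T)) (hv : MonotoneOn v (Icc 0 T))
    (hx : ∀ s ∈ Icc 0 T, ∀ t ∈ Icc 0 T, s ≤ t → ‖x t - x s‖ ≤ A * (w t - w s) ^ a)
    (hy : ∀ s ∈ Icc 0 T, ∀ t ∈ Icc 0 T, s ≤ t → ‖y t - y s‖ ≤ (v t - v s) ^ b)
    (hμ : 0 ≤ μ) (D D' : Dissection T) (hD : ∀ i ≤ D.n, ∃ k ≤ D'.n, D'.t k = D.t i)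
    (hmesh : ∀ i < D.n, w (D.t (i + 1)) - w (D.t i) ≤ μ)
    (τ : ℕ → ℝ) (hτ : ∀ i < D.n, τ i ∈ Icc (D.t i) (D.t (i + 1))) :
    ‖youngSum D' D'.t x y - youngSum D τ x y‖ ≤
      A * μ ^ (a - a') * (youngConst (a' + b) + 1) *
        ((w T + v T) - (w 0 + v 0)) ^ (a' + b) := by
  obtain ⟨k, hk0, hkn, hk, hkm⟩ := D.exists_index D' hD
  -- A single additive control for integrand and integrator, as the bisection requires.
  set g : ℝ → ℝ := fun t => w t + v t with hg
  have hgm : MonotoneOn g (Icc 0 T) := hw.add hv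
  have hK := youngConst_pos hab
  have hB : 0 ≤ A * μ ^ (a - a') := by positivity
  -- Lowering the exponent from a to a' gains the factor `μ ^ (a - a')`. All smallness comes from
  -- `w` in this way; `v` may jump.
  have hxg : ∀ s ∈ Icc 0 T, ∀ t ∈ Icc 0 T, s ≤ t → w t - w s ≤ μ →
      ‖x t - x s‖ ≤ A * μ ^ (a - a') * (g t - g s) ^ a' := by
    intro s hs t ht hst hws
    have h0 : 0 ≤ w t - w s := sub_nonneg.2 (hw hs ht hst)
    have h1 : 0 ≤ v t - v s := sub_nonneg.2 (hv hs ht hst)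
    calc ‖x t - x s‖ ≤ A * (w t - w s) ^ a := hx s hs t ht hst
      _ = A * ((w t - w s) ^ (a - a') * (w t - w s) ^ a') := by
          rw [← Real.rpow_add_of_nonneg h0 (by linarith) ha'.le]; ring_nf
      _ ≤ A * (μ ^ (a - a') * (g t - g s) ^ a') := by
          have : w t - w s ≤ g t - g s := by simp only [hg]; linarith
          gcongr
      _ = _ := by ring
  have hyg : ∀ s ∈ Icc 0 T, ∀ t ∈ Icc 0 T, s ≤ t → ‖y t - y s‖ ≤ (g t - g s) ^ b := by
    intro s hs t ht hst
    have h0 : 0 ≤ w t - w s := sub_nonneg.2 (hw hs ht hst)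
    have h1 : 0 ≤ v t - v s := sub_nonneg.2 (hv hs ht hst)
    refine (hy s hs t ht hst).trans (Real.rpow_le_rpow h1 ?_ hb.le)
    simp only [hg]; linarith
  have key : ∀ i < D.n, ‖(∑ l ∈ Finset.Ico (k i) (k (i + 1)),
        x (D'.t l) (y (D'.t (l + 1)) - y (D'.t l))) - x (τ i) (y (D.t (i + 1)) - y (D.t i))‖ ≤
      A * μ ^ (a - a') * (youngConst (a' + b) + 1) * (g (D.t (i + 1)) - g (D.t i)) ^ (a' + b) := by
    intro i hi
    have hti := D.mem_Icc hi.le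
    have hti' := D.mem_Icc (i := i + 1) hi
    have hτT : τ i ∈ Icc 0 T := ⟨hti.1.trans (hτ i hi).1, (hτ i hi).2.trans hti'.2⟩
    have hle := (D.lt i hi).le
    have hki := hk i hi.le
    have hki' := hk (i + 1) hi
    have hwin : ∀ l m, k i ≤ l → l ≤ m → m ≤ k (i + 1) → w (D'.t m) - w (D'.t l) ≤ μ := by
      intro l m h1 h2 h3
      have e1 : w (D'.t m) ≤ w (D.t (i + 1)) := by
        rw [← hki'.2]
        exact hw (D'.mem_Icc (h3.trans hki'.1)) (D'.mem_Icc hki'.1) (D'.mono h3 hki'.1)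
      have e2 : w (D.t i) ≤ w (D'.t l) := by
        rw [← hki.2]
        exact hw (D'.mem_Icc hki.1) (D'.mem_Icc (h2.trans (h3.trans hki'.1)))
          (D'.mono h1 (h2.trans (h3.trans hki'.1)))
      linarith [hmesh i hi]
    have hmem : ∀ l, l ≤ k (i + 1) - k i → D'.t (k i + l) ∈ Icc 0 T := fun l hl =>
      D'.mem_Icc (by have := hkm i hi; have := hki'.1; lia)
    have hmon : ∀ l m, l ≤ m → m ≤ k (i + 1) - k i → D'.t (k i + l) ≤ D'.t (k i + m) :=
      fun l m h1 h2 => D'.mono (by lia) (by have := hkm i hi; have := hki'.1; lia)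
    have hkk := hkm i hi
    have h1 := young_discrete (X := fun l => x (D'.t (k i + l))) (y := fun l => y (D'.t (k i + l)))
      (g := fun l => g (D'.t (k i + l))) (N := k (i + 1) - k i) hB ha' hb hab
      (fun l m h1 h2 => hgm (hmem l (h1.trans h2)) (hmem m h2) (hmon l m h1 h2))
      (fun l m h1 h2 => hxg _ (hmem l (h1.trans h2)) _ (hmem m h2) (hmon l m h1 h2)
        (hwin _ _ (by lia) (by lia) (by lia)))
      (fun l m h1 h2 => hyg _ (hmem l (h1.trans h2)) _ (hmem m h2) (hmon l m h1 h2))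
      (k (i + 1) - k i) 0 (k (i + 1) - k i) (Nat.zero_le _) le_rfl (by lia)
    simp only [add_zero, Nat.add_sub_cancel' hkk, hki.2, hki'.2] at h1
    rw [← Finset.range_eq_Ico] at h1
    -- Moving the tag from the left endpoint to `τ i` accounts for the `+ 1` next to `youngConst`.
    have h2 : ‖(x (τ i) - x (D.t i)) (y (D.t (i + 1)) - y (D.t i))‖ ≤
        A * μ ^ (a - a') * (g (D.t (i + 1)) - g (D.t i)) ^ (a' + b) := by
      have g1 : g (D.t i) ≤ g (τ i) := hgm hti hτT (hτ i hi).1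
      have g2 : g (τ i) ≤ g (D.t (i + 1)) := hgm hτT hti' (hτ i hi).2
      have hwτ : w (τ i) - w (D.t i) ≤ μ := by
        linarith [hmesh i hi, hw hτT hti' (hτ i hi).2]
      calc _ ≤ ‖x (τ i) - x (D.t i)‖ * ‖y (D.t (i + 1)) - y (D.t i)‖ :=
            ContinuousLinearMap.le_opNorm _ _
        _ ≤ (A * μ ^ (a - a') * (g (τ i) - g (D.t i)) ^ a') *
              (g (D.t (i + 1)) - g (D.t i)) ^ b := by
            gcongr
            · exact hxg _ hti _ hτT (hτ i hi).1 hwτ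
            · exact hyg _ hti _ hti' hle
        _ ≤ (A * μ ^ (a - a') * (g (D.t (i + 1)) - g (D.t i)) ^ a') *
              (g (D.t (i + 1)) - g (D.t i)) ^ b := by
            have : 0 ≤ g (τ i) - g (D.t i) := by linarith
            have : 0 ≤ g (D.t (i + 1)) - g (D.t i) := by linarith
            gcongr
        _ = _ := by
            rw [Real.rpow_add_of_nonneg (by linarith) ha'.le hb.le]; ring
    have hs : ∑ l ∈ Finset.Ico (k i) (k (i + 1)), x (D'.t l) (y (D'.t (l + 1)) - y (D'.t l)) =
        ∑ l ∈ Finset.range (k (i + 1) - k i),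
          x (D'.t (k i + l)) (y (D'.t (k i + (l + 1))) - y (D'.t (k i + l))) := by
      rw [Finset.sum_Ico_eq_sum_range]; rfl
    rw [hs]
    calc _ = ‖(∑ l ∈ Finset.range (k (i + 1) - k i),
          x (D'.t (k i + l)) (y (D'.t (k i + (l + 1))) - y (D'.t (k i + l))) -
          x (D.t i) (y (D.t (i + 1)) - y (D.t i))) -
          (x (τ i) - x (D.t i)) (y (D.t (i + 1)) - y (D.t i))‖ := by
          congr 1; simp only [sub_apply]; abel
      _ ≤ _ := norm_sub_le _ _
      _ ≤ _ := add_le_add h1 h2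
      _ = _ := by ring
  have hsplit : youngSum D' D'.t x y = ∑ i ∈ Finset.range D.n,
      ∑ l ∈ Finset.Ico (k i) (k (i + 1)), x (D'.t l) (y (D'.t (l + 1)) - y (D'.t l)) := by
    rw [sum_Ico_of_monotone _ k hk0 D.n hkm, hkn]; rfl
  have hGsum := sum_rpow_sub_le (n := D.n) (G := fun i => g (D.t i)) hab
    (fun i j hij hj => hgm (D.mem_Icc (hij.trans hj)) (D.mem_Icc hj) (D.mono hij hj))
  simp only [D.zero, D.last] at hGsum
  rw [hsplit, youngSum, ← Finset.sum_sub_distrib]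
  calc _ ≤ _ := norm_sum_le _ _
    _ ≤ ∑ i ∈ Finset.range D.n, A * μ ^ (a - a') * (youngConst (a' + b) + 1) *
          (g (D.t (i + 1)) - g (D.t i)) ^ (a' + b) :=
        Finset.sum_le_sum fun i hi => key i (Finset.mem_range.1 hi)
    _ ≤ _ := by
        rw [← Finset.mul_sum]
        gcongr

/-- Existence of the Young integral, with an estimate for the tagged sums that is uniform in the
integrand. -/
theorem exists_hasYoungIntegral [CompleteSpace W] {T : ℝ} (hT : 0 < T) {y : ℝ → V} {v : ℝ → ℝ}
    {a a' b : ℝ} (ha' : 0 < a') (haa : a' < a) (hb : 0 < b) (hab : 1 < a' + b)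
    (hv : MonotoneOn v (Icc 0 T))
    (hy : ∀ s ∈ Icc 0 T, ∀ t ∈ Icc 0 T, s ≤ t → ‖y t - y s‖ ≤ (v t - v s) ^ b) :
    ∃ C, 0 ≤ C ∧ ∀ (x : ℝ → V →L[ℝ] W) (w : ℝ → ℝ) (A : ℝ), 0 ≤ A → MonotoneOn w (Icc 0 T) →
      ContinuousOn w (Icc 0 T) → w T - w 0 ≤ 1 →
      (∀ s ∈ Icc 0 T, ∀ t ∈ Icc 0 T, s ≤ t → ‖x t - x s‖ ≤ A * (w t - w s) ^ a) →
      ∃ J, HasYoungIntegral T x y J ∧ ∀ (D : Dissection T) (τ : ℕ → ℝ) (μ : ℝ), 0 < μ →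
        (∀ i < D.n, w (D.t (i + 1)) - w (D.t i) ≤ μ) →
        (∀ i < D.n, τ i ∈ Icc (D.t i) (D.t (i + 1))) →
        ‖youngSum D τ x y - J‖ ≤ C * A * μ ^ (a - a') := by
  have hK := youngConst_pos hab
  have h0T : (0 : ℝ) ∈ Icc 0 T := ⟨le_rfl, hT.le⟩
  have hTT : T ∈ Icc 0 T := ⟨hT.le, le_rfl⟩
  have hv0 : 0 ≤ v T - v 0 := sub_nonneg.2 (hv h0T hTT hT.le)
  -- The 1 bounds the total increment of `w`, which makes the constant independent of the integrand.
  -- The 2 comes from comparing two dissections through a common refinement.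
  set C := 2 * ((youngConst (a' + b) + 1) * (1 + (v T - v 0)) ^ (a' + b)) with hC
  have hC0 : 0 ≤ C := by positivity
  refine ⟨C, hC0, fun x w A hA hw hwc hw1 hx => ?_⟩
  have hw0 : 0 ≤ w T - w 0 := sub_nonneg.2 (hw h0T hTT hT.le)
  have hcmp : ∀ (D₁ D₂ : Dissection T) (τ₁ τ₂ : ℕ → ℝ) (μ : ℝ), 0 < μ →
      (∀ i < D₁.n, w (D₁.t (i + 1)) - w (D₁.t i) ≤ μ) →
      (∀ i < D₂.n, w (D₂.t (i + 1)) - w (D₂.t i) ≤ μ) →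
      (∀ i < D₁.n, τ₁ i ∈ Icc (D₁.t i) (D₁.t (i + 1))) →
      (∀ i < D₂.n, τ₂ i ∈ Icc (D₂.t i) (D₂.t (i + 1))) →
      ‖youngSum D₁ τ₁ x y - youngSum D₂ τ₂ x y‖ ≤ C * A * μ ^ (a - a') := by
    intro D₁ D₂ τ₁ τ₂ μ hμ hm1 hm2 hτ1 hτ2
    obtain ⟨D, hD1, hD2⟩ := D₁.exists_common_refinement D₂
    have e1 := norm_youngSum_refine_sub_le hA ha' haa hb hab hw hv hx hy hμ.le D₁ D hD1 hm1 τ₁ hτ1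
    have e2 := norm_youngSum_refine_sub_le hA ha' haa hb hab hw hv hx hy hμ.le D₂ D hD2 hm2 τ₂ hτ2
    have e3 : A * μ ^ (a - a') * (youngConst (a' + b) + 1) *
        ((w T + v T) - (w 0 + v 0)) ^ (a' + b) ≤
        A * μ ^ (a - a') * (youngConst (a' + b) + 1) * (1 + (v T - v 0)) ^ (a' + b) := by
      have : (w T + v T) - (w 0 + v 0) ≤ 1 + (v T - v 0) := by linarith
      gcongr
      linarith
    calc _ = ‖(youngSum D D.t x y - youngSum D₂ τ₂ x y) -
          (youngSum D D.t x y - youngSum D₁ τ₁ x y)‖ := by congr 1; abel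
      _ ≤ _ := norm_sub_le _ _
      _ ≤ _ := add_le_add (e2.trans e3) (e1.trans e3)
      _ = _ := by rw [hC]; ring
  have hunif : ∀ μ > 0, ∃ δ > 0, ∀ D : Dissection T, (∀ i < D.n, D.t (i + 1) - D.t i < δ) →
      ∀ i < D.n, w (D.t (i + 1)) - w (D.t i) ≤ μ := by
    intro μ hμ
    have huc := isCompact_Icc.uniformContinuousOn_of_continuous hwc
    obtain ⟨δ, hδ, h⟩ := Metric.uniformContinuousOn_iff.1 huc μ hμ
    refine ⟨δ, hδ, fun D hD i hi => ?_⟩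
    have := h _ (D.mem_Icc (i := i + 1) hi) _ (D.mem_Icc hi.le) (by
      rw [Real.dist_eq, abs_of_nonneg (by linarith [D.lt i hi])]; exact hD i hi)
    exact (le_abs_self _).trans this.le
  have hsmall : ∀ ε > 0, ∃ μ > 0, C * A * μ ^ (a - a') < ε := by
    intro ε hε
    have h1 : Tendsto (fun μ : ℝ => C * A * μ ^ (a - a')) (𝓝[>] 0) (𝓝 (C * A * 0 ^ (a - a'))) :=
      ((Real.continuousAt_rpow_const 0 (a - a') (Or.inr (by linarith))).tendsto.const_mul _).mono_left
        nhdsWithin_le_nhds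
    rw [Real.zero_rpow (by linarith), mul_zero] at h1
    obtain ⟨μ, h2, h3⟩ := ((h1.eventually (gt_mem_nhds hε)).and self_mem_nhdsWithin).exists
    exact ⟨μ, h3, h2⟩
  have htag : ∀ D : Dissection T, ∀ i < D.n, D.t i ∈ Icc (D.t i) (D.t (i + 1)) :=
    fun D i hi => ⟨le_rfl, (D.lt i hi).le⟩
  let S : ℕ → W := fun m => youngSum (Dissection.uniform hT m) (Dissection.uniform hT m).t x y
  have hmesh : ∀ μ > 0, ∃ M, ∀ m ≥ M, ∀ i < (Dissection.uniform hT m).n,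
      w ((Dissection.uniform hT m).t (i + 1)) - w ((Dissection.uniform hT m).t i) ≤ μ := by
    intro μ hμ
    obtain ⟨δ, hδ, h⟩ := hunif μ hμ
    obtain ⟨M, hM⟩ := exists_nat_gt (T / δ)
    refine ⟨M, fun m hm => h _ fun i _ => ?_⟩
    rw [Dissection.uniform_mesh, div_lt_iff₀ (by positivity)]
    rw [div_lt_iff₀ hδ] at hM
    have : (M : ℝ) ≤ m := by exact_mod_cast hm
    nlinarith
  have hcau : CauchySeq S := by
    refine Metric.cauchySeq_iff.2 fun ε hε => ?_
    obtain ⟨μ, hμ, hμε⟩ := hsmall ε hε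
    obtain ⟨M, hM⟩ := hmesh μ hμ
    refine ⟨M, fun m hm n hn => ?_⟩
    rw [dist_eq_norm]
    exact (hcmp _ _ _ _ μ hμ (hM m hm) (hM n hn) (htag _) (htag _)).trans_lt hμε
  obtain ⟨J, hJ⟩ := cauchySeq_tendsto_of_complete hcau
  have hest : ∀ (D : Dissection T) (τ : ℕ → ℝ) (μ : ℝ), 0 < μ →
      (∀ i < D.n, w (D.t (i + 1)) - w (D.t i) ≤ μ) →
      (∀ i < D.n, τ i ∈ Icc (D.t i) (D.t (i + 1))) →
      ‖youngSum D τ x y - J‖ ≤ C * A * μ ^ (a - a') := by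
    intro D τ μ hμ hD hτ
    obtain ⟨M, hM⟩ := hmesh μ hμ
    refine le_of_tendsto ((tendsto_const_nhds.sub hJ).norm) ?_
    filter_upwards [eventually_ge_atTop M] with m hm
    exact hcmp _ _ _ _ μ hμ hD (hM m hm) hτ (htag _)
  refine ⟨J, fun ε hε => ?_, hest⟩
  obtain ⟨μ, hμ, hμε⟩ := hsmall ε hε
  obtain ⟨δ, hδ, h⟩ := hunif μ hμ
  exact ⟨δ, hδ, fun D hD τ hτ => (hest D τ μ hμ (h D hD) hτ).trans_lt hμε⟩

end Young

/-! ### Finite p-variation and controls of increments. -/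

section Control

variable {V : Type*} [NormedAddCommGroup V]

/-- Extend a dissection of `[0, s]` by the point `t > s`. -/
noncomputable def Dissection.append {s t : ℝ} (D : Dissection s) (h : s < t) : Dissection t where
  n := D.n + 1
  t i := if i ≤ D.n then D.t i else t
  zero := by simp [D.zero]
  last := by simp
  lt i hi := by
    rcases (Nat.lt_succ_iff.1 hi).eq_or_lt with h' | h'
    · simp [h', D.last, h]
    · rw [if_pos h'.le, if_pos (show i + 1 ≤ D.n from h')]
      exact D.lt i h'

/-- The supremum of the sums of `p`-th powers of increments over the dissections of `[0, t]`. -/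
noncomputable def pSum (p : ℝ) (y : ℝ → V) (t : ℝ) : ℝ≥0∞ :=
  ⨆ D : Dissection t,
    ∑ i ∈ Finset.range D.n, ENNReal.ofReal (‖y (D.t (i + 1)) - y (D.t i)‖ ^ p)

lemma nonempty_dissection {s : ℝ} (hs : 0 ≤ s) : Nonempty (Dissection s) := by
  rcases hs.eq_or_lt with rfl | h
  · exact ⟨⟨0, fun _ => 0, rfl, rfl, fun i hi => absurd hi (Nat.not_lt_zero i)⟩⟩
  · exact ⟨Dissection.uniform h 0⟩

/-- Appending t to a dissection of [0, s] adds one term. This superadditivity is what makes t ↦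
`pSum p y t` a control. -/
lemma pSum_add_le (p : ℝ) (y : ℝ → V) {s t : ℝ} (hs : 0 ≤ s) (hst : s < t) :
    pSum p y s + ENNReal.ofReal (‖y t - y s‖ ^ p) ≤ pSum p y t := by
  have := nonempty_dissection hs
  rw [pSum, ENNReal.iSup_add]
  refine iSup_le fun D => ?_
  refine le_trans (le_of_eq ?_) (le_iSup _ (D.append hst))
  simp only [Dissection.append]
  rw [Finset.sum_range_succ]
  congr 1
  · refine Finset.sum_congr rfl fun i hi => ?_
    have hi := Finset.mem_range.1 hi
    rw [if_pos (show i + 1 ≤ D.n from hi), if_pos hi.le]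
  · simp [D.last]

/-- A function of finite `p`-variation admits an additive control of its increments. -/
lemma exists_control {p T : ℝ} (hp : 0 < p) {y : ℝ → V} (hy : pVariation p T y < ⊤) :
    ∃ v : ℝ → ℝ, MonotoneOn v (Icc 0 T) ∧
      ∀ s ∈ Icc 0 T, ∀ t ∈ Icc 0 T, s ≤ t → ‖y t - y s‖ ≤ (v t - v s) ^ (1 / p) := by
  have hfin : pSum p y T < ⊤ := by
    by_contra h
    rw [not_lt, top_le_iff] at h
    simp only [pVariation] at hy
    rw [pSum] at h
    rw [h, ENNReal.top_rpow_of_pos (by positivity)] at hy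
    exact lt_irrefl _ hy
  have hle : ∀ s t, 0 ≤ s → s ≤ t → pSum p y s ≤ pSum p y t := by
    intro s t hs hst
    rcases hst.eq_or_lt with rfl | h
    · exact le_rfl
    · exact le_self_add.trans (pSum_add_le p y hs h)
  have hne : ∀ t ∈ Icc 0 T, pSum p y t ≠ ⊤ := fun t ht => ((hle t T ht.1 ht.2).trans_lt hfin).ne
  refine ⟨fun t => (pSum p y t).toReal, fun s hs t ht hst =>
    ENNReal.toReal_mono (hne t ht) (hle s t hs.1 hst), fun s hs t ht hst => ?_⟩
  rcases hst.eq_or_lt with rfl | h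
  · simp; positivity
  have h1 := ENNReal.toReal_mono (hne t ht) (pSum_add_le p y hs.1 h)
  rw [ENNReal.toReal_add (hne s hs) ENNReal.ofReal_ne_top,
    ENNReal.toReal_ofReal (by positivity)] at h1
  have h2 : ‖y t - y s‖ ^ p ≤ (pSum p y t).toReal - (pSum p y s).toReal := by linarith
  calc ‖y t - y s‖ = (‖y t - y s‖ ^ p) ^ (1 / p) := by
        rw [← Real.rpow_mul (norm_nonneg _), mul_one_div_cancel hp.ne', Real.rpow_one]
    _ ≤ _ := Real.rpow_le_rpow (by positivity) h2 (by positivity)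

/-- A path whose increments are controlled by `A (w t - w s) ^ a` has finite `1 / a`-variation. -/
lemma pVariation_lt_top_of_control {T A a : ℝ} (ha : 0 < a) (hA : 0 ≤ A) {x : ℝ → V} {w : ℝ → ℝ}
    (hw : MonotoneOn w (Icc 0 T))
    (hx : ∀ s ∈ Icc 0 T, ∀ t ∈ Icc 0 T, s ≤ t → ‖x t - x s‖ ≤ A * (w t - w s) ^ a) :
    pVariation (1 / a) T x < ⊤ := by
  refine ENNReal.rpow_lt_top_of_nonneg (by positivity) (ne_of_lt ?_)
  refine lt_of_le_of_lt (iSup_le (a := ENNReal.ofReal (A ^ (1 / a) * (w T - w 0))) fun D => ?_)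
    ENNReal.ofReal_lt_top
  rw [← ENNReal.ofReal_sum_of_nonneg (fun i _ => by positivity)]
  refine ENNReal.ofReal_le_ofReal ?_
  calc ∑ i ∈ Finset.range D.n, ‖x (D.t (i + 1)) - x (D.t i)‖ ^ (1 / a)
      ≤ ∑ i ∈ Finset.range D.n, A ^ (1 / a) * (w (D.t (i + 1)) - w (D.t i)) := by
        refine Finset.sum_le_sum fun i hi => ?_
        have hi := Finset.mem_range.1 hi
        have h1 := D.mem_Icc hi.le
        have h2 := D.mem_Icc (i := i + 1) hi
        have h0 := sub_nonneg.2 (hw h1 h2 (D.lt i hi).le)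
        calc _ ≤ (A * (w (D.t (i + 1)) - w (D.t i)) ^ a) ^ (1 / a) :=
              Real.rpow_le_rpow (norm_nonneg _) (hx _ h1 _ h2 (D.lt i hi).le) (by positivity)
          _ = _ := by
              rw [Real.mul_rpow hA (by positivity), ← Real.rpow_mul h0,
                mul_one_div_cancel ha.ne', Real.rpow_one]
    _ = A ^ (1 / a) * (w T - w 0) := by
        rw [← Finset.mul_sum, Finset.sum_range_sub (fun i => w (D.t i)), D.last, D.zero]

end Control

/-! ### Paths with speed bounded in L^r: equicontinuity, limits, fundamental theorem of calculus. -/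

section Paths

/-- The increments of `x` are dominated by the integrals of `v`, whose `r`-th power has integral at
most `B`. -/
structure HasSpeed {F : Type*} [NormedAddCommGroup F] (r T B : ℝ) (x : ℝ → F) (v : ℝ → ℝ) :
    Prop where
  nonneg : ∀ t, 0 ≤ v t
  integrable : IntegrableOn v (Icc 0 T)
  integrable_rpow : IntegrableOn (fun t => v t ^ r) (Icc 0 T)
  integral_rpow_le : ∫ t in Icc 0 T, v t ^ r ≤ B
  le : ∀ s ∈ Icc 0 T, ∀ t ∈ Icc 0 T, s ≤ t → ‖x t - x s‖ ≤ ∫ τ in Ioc s t, v τ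

variable {F : Type*} [NormedAddCommGroup F] {r T B : ℝ}

/-- Above the level l, the factor `a ^ (1 - r)` is at most `l ^ (1 - r)`. This substitute for
Hölder's inequality gives uniform integrability for large l, and an L^1 bound when l is the L^r
bound itself. -/
lemma le_add_rpow {r l a : ℝ} (hr : 1 ≤ r) (hl : 0 < l) (ha : 0 ≤ a) :
    a ≤ l + l ^ (1 - r) * a ^ r := by
  rcases le_total a l with h | h
  · have : 0 ≤ l ^ (1 - r) * a ^ r := by positivity
    linarith
  · have ha' : 0 < a := hl.trans_le h
    have h1 : a ^ (1 - r) ≤ l ^ (1 - r) := Real.rpow_le_rpow_of_nonpos hl h (by linarith)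
    calc a = a ^ (1 - r) * a ^ r := by rw [← Real.rpow_add ha']; simp
      _ ≤ l ^ (1 - r) * a ^ r := by gcongr
      _ ≤ _ := by linarith

/-- Uniform integrability from a uniform bound in `L^r`, `r > 1`. -/
lemma exists_setIntegral_le (hr : 1 < r) (B : ℝ) {ε : ℝ} (hε : 0 < ε) :
    ∃ δ > 0, ∀ (x : ℝ → F) (v : ℝ → ℝ), HasSpeed r T B x v → ∀ S : Set ℝ, MeasurableSet S →
      S ⊆ Icc 0 T → volume.real S ≤ δ → ∫ t in S, v t ≤ ε := by
  obtain ⟨l, hl, hlB⟩ : ∃ l > 0, l ^ (1 - r) * |B| < ε / 2 := by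
    have h1 : Tendsto (fun l : ℝ => l ^ (-(r - 1)) * |B|) atTop (𝓝 (0 * |B|)) :=
      (tendsto_rpow_neg_atTop (by linarith)).mul_const _
    rw [zero_mul] at h1
    obtain ⟨l, h2, h3⟩ :=
      ((h1.eventually (gt_mem_nhds (half_pos hε))).and (eventually_gt_atTop 0)).exists
    exact ⟨l, h3, by rwa [neg_sub] at h2⟩
  refine ⟨ε / (2 * l), by positivity, fun x v h S hS hST hvol => ?_⟩
  have hfin : volume S ≠ ⊤ := ne_top_of_le_ne_top (by simp) (measure_mono hST)
  have hi1 : IntegrableOn (fun t => l ^ (1 - r) * v t ^ r) S :=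
    (h.integrable_rpow.mono_set hST).const_mul _
  have hi0 : IntegrableOn (fun _ : ℝ => l) S := integrableOn_const hfin
  calc ∫ t in S, v t ≤ ∫ t in S, (l + l ^ (1 - r) * v t ^ r) :=
        setIntegral_mono (h.integrable.mono_set hST) (hi0.add hi1)
          fun t => le_add_rpow hr.le hl (h.nonneg t)
    _ = volume.real S * l + l ^ (1 - r) * ∫ t in S, v t ^ r := by
        rw [integral_add hi0 hi1, integral_const_mul, setIntegral_const, smul_eq_mul]
    _ ≤ ε / (2 * l) * l + l ^ (1 - r) * |B| := by
        have : ∫ t in S, v t ^ r ≤ |B| :=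
          (setIntegral_mono_set h.integrable_rpow
            (Eventually.of_forall fun t => Real.rpow_nonneg (h.nonneg t) r)
            hST.eventuallyLE).trans (h.integral_rpow_le.trans (le_abs_self B))
        gcongr
    _ ≤ ε := by
        have : ε / (2 * l) * l = ε / 2 := by field_simp
        linarith

/-- Paths with a common bound on their speeds are equicontinuous. -/
lemma exists_norm_sub_le (hr : 1 < r) (B : ℝ) {ε : ℝ} (hε : 0 < ε) :
    ∃ δ > 0, ∀ (x : ℝ → F) (v : ℝ → ℝ), HasSpeed r T B x v → ∀ s ∈ Icc 0 T, ∀ t ∈ Icc 0 T,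
      |t - s| ≤ δ → ‖x t - x s‖ ≤ ε := by
  obtain ⟨δ, hδ, h⟩ := exists_setIntegral_le (F := F) (T := T) hr B hε
  refine ⟨δ, hδ, fun x v hx => ?_⟩
  have key : ∀ s ∈ Icc 0 T, ∀ t ∈ Icc 0 T, s ≤ t → |t - s| ≤ δ → ‖x t - x s‖ ≤ ε := by
    intro s hs t ht hst hd
    refine (hx.le s hs t ht hst).trans (h x v hx _ measurableSet_Ioc
      (fun τ hτ => ⟨hs.1.trans hτ.1.le, hτ.2.trans ht.2⟩) ?_)
    rw [Real.volume_real_Ioc_of_le hst]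
    exact (le_abs_self _).trans hd
  intro s hs t ht hd
  rcases le_total s t with hst | hst
  · exact key s hs t ht hst hd
  · rw [norm_sub_rev]
    exact key t ht s hs hst (by rwa [abs_sub_comm])

lemma HasSpeed.continuousOn (hr : 1 < r) {x : ℝ → F} {v : ℝ → ℝ} (h : HasSpeed r T B x v) :
    ContinuousOn x (Icc 0 T) := by
  refine Metric.continuousOn_iff.2 fun t ht ε hε => ?_
  obtain ⟨δ, hδ, hd⟩ := exists_norm_sub_le (F := F) (T := T) hr B (half_pos hε)
  refine ⟨δ, hδ, fun s hs hst => ?_⟩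
  rw [dist_eq_norm]
  exact (hd x v h t ht s hs hst.le).trans_lt (half_lt_self hε)

lemma HasSpeed.dist_le {x : ℝ → F} {v : ℝ → ℝ} (h : HasSpeed r T B x v) {s t : ℝ}
    (hs : s ∈ Icc 0 T) (ht : t ∈ Icc 0 T) : dist (x s) (x t) ≤ ∫ τ in uIoc s t, v τ := by
  rcases le_total s t with hst | hst
  · rw [uIoc_of_le hst, dist_comm, dist_eq_norm]
    exact h.le s hs t ht hst
  · rw [uIoc_of_ge hst, dist_eq_norm]
    exact h.le t ht s hs hst

/-- Pointwise limits of paths with a common bound on their speeds are absolutely continuous. -/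
lemma absolutelyContinuousOnInterval_of_tendsto (hT : 0 ≤ T) (hr : 1 < r) {x : ℕ → ℝ → F}
    {v : ℕ → ℝ → ℝ} (h : ∀ n, HasSpeed r T B (x n) (v n)) {z : ℝ → F}
    (hz : ∀ t ∈ Icc 0 T, Tendsto (fun n => x n t) atTop (𝓝 (z t))) :
    AbsolutelyContinuousOnInterval z 0 T := by
  rw [absolutelyContinuousOnInterval_iff]
  intro ε hε
  obtain ⟨δ, hδ, hd⟩ := exists_setIntegral_le (F := F) (T := T) hr B (half_pos hε)
  refine ⟨δ, hδ, fun E hE hlen => ?_⟩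
  obtain ⟨hE1, hE2⟩ := hE
  rw [uIcc_of_le hT] at hE1
  refine lt_of_le_of_lt (le_of_tendsto (x := atTop) (f := fun n =>
    ∑ i ∈ Finset.range E.1, dist (x n (E.2 i).1) (x n (E.2 i).2)) ?_
    (Eventually.of_forall fun n => ?_)) (half_lt_self hε)
  · exact tendsto_finsetSum _ fun i hi => (hz _ (hE1 i hi).1).dist (hz _ (hE1 i hi).2)
  have hsub : ∀ i ∈ Finset.range E.1, uIoc (E.2 i).1 (E.2 i).2 ⊆ Icc 0 T := by
    intro i hi τ hτ
    rw [mem_uIoc] at hτ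
    have := hE1 i hi
    rcases hτ with h | h
    · exact ⟨this.1.1.trans h.1.le, h.2.trans this.2.2⟩
    · exact ⟨this.2.1.trans h.1.le, h.2.trans this.1.2⟩
  -- The intervals are pairwise disjoint, so their integrals merge into one over a set of small
  -- measure, where uniform integrability applies for all n at once.
  calc _ ≤ ∑ i ∈ Finset.range E.1, ∫ τ in uIoc (E.2 i).1 (E.2 i).2, v n τ :=
        Finset.sum_le_sum fun i hi => (h n).dist_le (hE1 i hi).1 (hE1 i hi).2
    _ = ∫ τ in ⋃ i ∈ Finset.range E.1, uIoc (E.2 i).1 (E.2 i).2, v n τ :=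
        (integral_biUnion_finset _ (fun i _ => measurableSet_uIoc) hE2
          fun i hi => (h n).integrable.mono_set (hsub i hi)).symm
    _ ≤ ε / 2 := by
        refine hd _ _ (h n) _ (Finset.measurableSet_biUnion _ fun i _ => measurableSet_uIoc)
          (iUnion₂_subset hsub) ?_
        refine le_trans ?_ hlen.le
        refine (measureReal_biUnion_finset_le _ _).trans (Finset.sum_le_sum fun i _ => le_of_eq ?_)
        rw [uIoc, Real.volume_real_Ioc_of_le inf_le_sup, Real.dist_eq, max_sub_min_eq_abs']

/-- **Arzelà-Ascoli** for a sequence of paths. -/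
lemma exists_subseq_tendstoUniformlyOn [ProperSpace F] (hT : 0 ≤ T) {z : ℕ → ℝ → F} {R : ℝ}
    (hb : ∀ n, ∀ t ∈ Icc 0 T, ‖z n t‖ ≤ R)
    (heq : ∀ ε > 0, ∃ δ > 0, ∀ n, ∀ s ∈ Icc 0 T, ∀ t ∈ Icc 0 T, |t - s| ≤ δ →
      ‖z n t - z n s‖ ≤ ε) :
    ∃ (y : ℝ → F) (k : ℕ → ℕ), Continuous y ∧ StrictMono k ∧
      TendstoUniformlyOn (fun n => z (k n)) y atTop (Icc 0 T) := by
  have hcont : ∀ n, ContinuousOn (z n) (Icc 0 T) := by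
    intro n
    refine Metric.continuousOn_iff.2 fun t ht ε hε => ?_
    obtain ⟨δ, hδ, h⟩ := heq (ε / 2) (half_pos hε)
    refine ⟨δ, hδ, fun s hs hst => ?_⟩
    rw [dist_eq_norm]
    exact (h n t ht s hs hst.le).trans_lt (half_lt_self hε)
  let f : ℕ → BoundedContinuousFunction (Icc 0 T) F := fun n =>
    BoundedContinuousFunction.mkOfCompact ⟨(Icc 0 T).domRestrict (z n), (hcont n).domRestrict⟩
  have hcomp := BoundedContinuousFunction.arzela_ascoli (Metric.closedBall (0 : F) R)
    (isCompact_closedBall 0 R) (range f)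
    (by
      rintro _ t ⟨n, rfl⟩
      rw [mem_closedBall_zero_iff]
      exact hb n t t.2)
    (by
      intro t
      refine Metric.equicontinuousAt_iff.2 fun ε hε => ?_
      obtain ⟨δ, hδ, h⟩ := heq (ε / 2) (half_pos hε)
      refine ⟨δ, hδ, fun s hs i => ?_⟩
      obtain ⟨_, n, rfl⟩ := i
      rw [dist_comm, dist_eq_norm]
      exact (h n t t.2 s s.2 hs.le).trans_lt (half_lt_self hε))
  obtain ⟨y, -, k, hk, hy⟩ := hcomp.tendsto_subseq (x := f)
    (fun n => subset_closure (mem_range_self n))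
  refine ⟨IccExtend hT y, k, y.continuous.Icc_extend', hk, ?_⟩
  rw [BoundedContinuousFunction.tendsto_iff_tendstoUniformly] at hy
  rw [Metric.tendstoUniformlyOn_iff]
  intro ε hε
  filter_upwards [Metric.tendstoUniformly_iff.1 hy ε hε] with n hn t ht
  rw [IccExtend_of_mem hT _ ht]
  exact hn ⟨t, ht⟩

variable [NormedSpace ℝ F] [CompleteSpace F]

/-- Fundamental theorem of calculus for absolutely continuous vector-valued paths. -/
lemma sub_eq_intervalIntegral (hT : 0 ≤ T) {x v : ℝ → F}
    (hx : AbsolutelyContinuousOnInterval x 0 T) (hv : IntegrableOn v (Icc 0 T))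
    (hd : ∀ᵐ t ∂(volume.restrict (Icc 0 T)), HasDerivAt x (v t) t) {s t : ℝ}
    (hs : s ∈ Icc 0 T) (ht : t ∈ Icc 0 T) : x t - x s = ∫ τ in s..t, v τ := by
  have hvi : IntervalIntegrable v volume 0 T :=
    (intervalIntegrable_iff_integrableOn_Icc_of_le hT).2 hv
  have hsub : ∀ a ∈ Icc 0 T, ∀ b ∈ Icc 0 T, IntervalIntegrable v volume a b := by
    intro a ha b hb
    refine hvi.mono_set ?_
    rw [uIcc_of_le hT]
    exact (convex_Icc 0 T).ordConnected.uIcc_subset ha hb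
  have h0 : (0 : ℝ) ∈ Icc 0 T := ⟨le_rfl, hT⟩
  let y : ℝ → F := fun t => ∫ τ in (0 : ℝ)..t, v τ
  -- The increments of the vector-valued primitive are dominated by those of the scalar primitive of
  -- `‖v‖`. Then `x - y` is absolutely continuous with derivative zero almost everywhere, hence
  -- constant.
  have hy : AbsolutelyContinuousOnInterval y 0 T := by
    have h1 := hvi.norm.absolutelyContinuousOnInterval_intervalIntegral (c := 0) left_mem_uIcc
    rw [absolutelyContinuousOnInterval_iff] at h1 ⊢
    intro ε hε
    obtain ⟨δ, hδ, h⟩ := h1 ε hε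
    refine ⟨δ, hδ, fun E hE hlen => lt_of_le_of_lt (Finset.sum_le_sum fun i hi => ?_) (h E hE hlen)⟩
    have hE1 := hE.1 i hi
    rw [uIcc_of_le hT] at hE1
    rw [dist_comm, dist_eq_norm, dist_comm, Real.dist_eq]
    rw [intervalIntegral.integral_interval_sub_left (hsub _ h0 _ hE1.2) (hsub _ h0 _ hE1.1),
      intervalIntegral.integral_interval_sub_left (hsub _ h0 _ hE1.2).norm
        (hsub _ h0 _ hE1.1).norm]
    exact intervalIntegral.norm_integral_le_abs_integral_norm
  obtain ⟨c, hc⟩ := (hx.sub hy).const_of_ae_hasDerivAt_zero (by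
    rw [ae_restrict_iff' measurableSet_Icc] at hd
    filter_upwards [hd, hvi.ae_hasDerivAt_integral] with t h1 h2 h3
    rw [uIcc_of_le hT] at h3 h2
    have := (h1 h3).sub (h2 h3 0 h0)
    rwa [sub_self] at this)
  rw [uIcc_of_le hT] at hc
  have e1 := hc t ht
  have e2 := hc s hs
  simp only [Pi.sub_apply] at e1 e2
  rw [← intervalIntegral.integral_interval_sub_left (hsub _ h0 _ ht) (hsub _ h0 _ hs)]
  change x t - x s = y t - y s
  rw [sub_eq_iff_eq_add] at e1 e2
  rw [e1, e2]
  abel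

end Paths

/-! ### State equation and control constraint in the limit. -/

section Limits

variable {E : Type*} [NormedAddCommGroup E]
  {T : ℝ}

lemma intervalIntegrable_of_Icc {F : Type*} [NormedAddCommGroup F] {v : ℝ → F}
    (hv : IntegrableOn v (Icc 0 T)) {s t : ℝ} (hs : s ∈ Icc 0 T) (ht : t ∈ Icc 0 T) :
    IntervalIntegrable v volume s t :=
  (hv.mono_set ((convex_Icc 0 T).ordConnected.uIcc_subset hs ht)).intervalIntegrable

lemma continuousOn_comp_path {G : Type*} [TopologicalSpace G] {h : ℝ → E → G}
    (hh : ContinuousOn (fun z : ℝ × E => h z.1 z.2) (Icc 0 T ×ˢ univ)) {x : ℝ → E}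
    (hx : ContinuousOn x (Icc 0 T)) : ContinuousOn (fun t => h t (x t)) (Icc 0 T) :=
  hh.comp (f := fun t => (t, x t)) (continuousOn_id.prodMk hx) fun _ ht => ⟨ht, mem_univ _⟩

variable [NormedSpace ℝ E] [FiniteDimensional ℝ E] {f : ℝ → E → E} {g : ℝ → E → E →L[ℝ] E}

/-- The right-hand side of the state equation is integrable. -/
lemma integrableOn_rhs (hf : ContinuousOn (fun z : ℝ × E => f z.1 z.2) (Icc 0 T ×ˢ univ))
    (hg : ContinuousOn (fun z : ℝ × E => g z.1 z.2) (Icc 0 T ×ˢ univ)) {x u : ℝ → E}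
    (hx : ContinuousOn x (Icc 0 T)) (hu : IntegrableOn u (Icc 0 T)) :
    IntegrableOn (fun t => f t (x t) + g t (x t) (u t)) (Icc 0 T) := by
  have hgx := continuousOn_comp_path hg hx
  obtain ⟨C, hC⟩ := isCompact_Icc.exists_bound_of_continuousOn hgx
  refine ((continuousOn_comp_path hf hx).integrableOn_compact isCompact_Icc).add ?_
  refine Integrable.mono' (hu.norm.const_mul C)
    (isBoundedBilinearMap_apply.continuous.comp_aestronglyMeasurable
      ((hgx.aestronglyMeasurable measurableSet_Icc).prodMk hu.aestronglyMeasurable)) ?_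
  refine (ae_restrict_iff' measurableSet_Icc).2 (Eventually.of_forall fun t ht => ?_)
  exact (ContinuousLinearMap.le_opNorm _ _).trans (by gcongr; exact hC t ht)

/-- The state equation passes to the limit at the points where the limits of the primitives of the
controls and of their norms are differentiable. -/
lemma hasDerivAt_of_limit (hT : 0 ≤ T)
    (hf : ContinuousOn (fun z : ℝ × E => f z.1 z.2) (Icc 0 T ×ˢ univ))
    (hg : ContinuousOn (fun z : ℝ × E => g z.1 z.2) (Icc 0 T ×ˢ univ)) {x u : ℕ → ℝ → E}
    (hxc : ∀ n, ContinuousOn (x n) (Icc 0 T)) (hu : ∀ n, IntegrableOn (u n) (Icc 0 T))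
    (hode : ∀ n, ∀ s ∈ Icc 0 T, ∀ t ∈ Icc 0 T,
      x n t - x n s = ∫ τ in s..t, (f τ (x n τ) + g τ (x n τ) (u n τ)))
    {z : ℝ → E} (hz : Continuous z) (hxz : TendstoUniformlyOn x z atTop (Icc 0 T))
    {P : ℝ → E} {Q : ℝ → ℝ}
    (hP : ∀ t ∈ Icc 0 T, Tendsto (fun n => ∫ τ in (0 : ℝ)..t, u n τ) atTop (𝓝 (P t)))
    (hQ : ∀ t ∈ Icc 0 T, Tendsto (fun n => ∫ τ in (0 : ℝ)..t, ‖u n τ‖) atTop (𝓝 (Q t)))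
    {t₀ : ℝ} (ht₀ : t₀ ∈ Ioo 0 T) {p : E} {q : ℝ} (hPd : HasDerivAt P p t₀)
    (hQd : HasDerivAt Q q t₀) :
    HasDerivAt z (f t₀ (z t₀) + g t₀ (z t₀) p) t₀ := by
  have h0 : (0 : ℝ) ∈ Icc 0 T := ⟨le_rfl, hT⟩
  have ht₀' := Ioo_subset_Icc_self ht₀
  have hnhd : Icc 0 T ∈ 𝓝 t₀ := Icc_mem_nhds ht₀.1 ht₀.2
  -- Near `t₀`, and for large n, the coefficients along `x n` are within ε of their frozen values at
  -- `(t₀, z t₀)`. The integrand error is then at most ε + ε `‖u n‖`, and its integral is an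
  -- increment of primitives with known limits.
  have main : ∀ ε > 0, ∀ᶠ t in 𝓝 t₀,
      ‖z t - z t₀ - (t - t₀) • f t₀ (z t₀) - g t₀ (z t₀) (P t - P t₀)‖ ≤
        ε * (|t - t₀| + |Q t - Q t₀|) := by
    intro ε hε
    have hfc := Metric.continuousWithinAt_iff.1 (hf (t₀, z t₀) ⟨ht₀', mem_univ _⟩) ε hε
    have hgc := Metric.continuousWithinAt_iff.1 (hg (t₀, z t₀) ⟨ht₀', mem_univ _⟩) ε hε
    obtain ⟨δ₁, hδ₁, hf1⟩ := hfc
    obtain ⟨δ₂, hδ₂, hg1⟩ := hgc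
    set δ := min δ₁ δ₂
    have hδ : 0 < δ := lt_min hδ₁ hδ₂
    obtain ⟨ρ, hρ, hρz⟩ := Metric.continuousAt_iff.1 hz.continuousAt (δ / 2) (half_pos hδ)
    have hball : Metric.ball t₀ (min ρ δ) ∈ 𝓝 t₀ := Metric.ball_mem_nhds _ (lt_min hρ hδ)
    filter_upwards [hnhd, hball] with t ht htb
    rw [Metric.mem_ball, Real.dist_eq] at htb
    have hlim : Tendsto (fun n => x n t - x n t₀ - (t - t₀) • f t₀ (z t₀) -
        g t₀ (z t₀) ((∫ τ in (0 : ℝ)..t, u n τ) - ∫ τ in (0 : ℝ)..t₀, u n τ)) atTop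
        (𝓝 (z t - z t₀ - (t - t₀) • f t₀ (z t₀) - g t₀ (z t₀) (P t - P t₀))) :=
      (((hxz.tendsto_at ht).sub (hxz.tendsto_at ht₀')).sub tendsto_const_nhds).sub
        (((g t₀ (z t₀)).continuous.tendsto _).comp ((hP t ht).sub (hP t₀ ht₀')))
    have hlim2 : Tendsto (fun n => ε * (|t - t₀| +
        |(∫ τ in (0 : ℝ)..t, ‖u n τ‖) - ∫ τ in (0 : ℝ)..t₀, ‖u n τ‖|)) atTop
        (𝓝 (ε * (|t - t₀| + |Q t - Q t₀|))) :=
      (tendsto_const_nhds.add ((hQ t ht).sub (hQ t₀ ht₀')).abs).const_mul ε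
    refine le_of_tendsto_of_tendsto hlim.norm hlim2 ?_
    filter_upwards [Metric.tendstoUniformlyOn_iff.1 hxz (δ / 2) (half_pos hδ)] with n hn
    have hui := intervalIntegrable_of_Icc (hu n) ht₀' ht
    have hri := intervalIntegrable_of_Icc (integrableOn_rhs hf hg (hxc n) (hu n)) ht₀' ht
    rw [intervalIntegral.integral_interval_sub_left (intervalIntegrable_of_Icc (hu n) h0 ht)
        (intervalIntegrable_of_Icc (hu n) h0 ht₀'),
      intervalIntegral.integral_interval_sub_left (intervalIntegrable_of_Icc (hu n).norm h0 ht)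
        (intervalIntegrable_of_Icc (hu n).norm h0 ht₀'), hode n t₀ ht₀' t ht,
      ← ContinuousLinearMap.intervalIntegral_comp_comm _ hui,
      ← intervalIntegral.integral_const, ← intervalIntegral.integral_sub hri intervalIntegrable_const,
      ← intervalIntegral.integral_sub (hri.sub intervalIntegrable_const)
        ⟨(g t₀ (z t₀)).integrable_comp hui.1, (g t₀ (z t₀)).integrable_comp hui.2⟩]
    have hb : ∀ τ ∈ uIoc t₀ t, ‖f τ (x n τ) + g τ (x n τ) (u n τ) - f t₀ (z t₀) -
        g t₀ (z t₀) (u n τ)‖ ≤ ε + ε * ‖u n τ‖ := by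
      intro τ hτ
      have hτ' := uIoc_subset_uIcc hτ
      have hτT := (convex_Icc 0 T).ordConnected.uIcc_subset ht₀' ht hτ'
      have hτt : |τ - t₀| ≤ |t - t₀| := abs_sub_left_of_mem_uIcc hτ'
      have hd : dist (τ, x n τ) (t₀, z t₀) < δ := by
        rw [Prod.dist_eq, max_lt_iff]
        constructor
        · simp only [Real.dist_eq]
          exact hτt.trans_lt (htb.trans_le (min_le_right _ _))
        · calc dist (x n τ) (z t₀) ≤ dist (x n τ) (z τ) + dist (z τ) (z t₀) := dist_triangle _ _ _
            _ < δ / 2 + δ / 2 := by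
                refine add_lt_add ?_ (hρz ?_)
                · rw [dist_comm]; exact hn τ hτT
                · rw [Real.dist_eq]
                  exact hτt.trans_lt (htb.trans_le (min_le_left _ _))
            _ = δ := add_halves δ
      have e1 := hf1 ⟨hτT, mem_univ _⟩ (hd.trans_le (min_le_left _ _))
      have e2 := hg1 ⟨hτT, mem_univ _⟩ (hd.trans_le (min_le_right _ _))
      rw [dist_eq_norm] at e1 e2
      calc _ = ‖(f τ (x n τ) - f t₀ (z t₀)) + (g τ (x n τ) - g t₀ (z t₀)) (u n τ)‖ := by
            congr 1; simp only [sub_apply]; abel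
        _ ≤ _ := norm_add_le _ _
        _ ≤ ε + ε * ‖u n τ‖ := by
            refine add_le_add e1.le ((ContinuousLinearMap.le_opNorm _ _).trans ?_)
            gcongr
    have hbi : IntervalIntegrable (fun τ => ε + ε * ‖u n τ‖) volume t₀ t :=
      (by simp : IntervalIntegrable (fun _ : ℝ => ε) volume t₀ t).add (hui.norm.const_mul ε)
    calc _ ≤ |∫ τ in t₀..t, (ε + ε * ‖u n τ‖)| :=
          intervalIntegral.norm_integral_le_abs_of_norm_le
            ((ae_restrict_iff' measurableSet_uIoc).2 (Eventually.of_forall hb)) hbi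
      _ = |ε * (t - t₀) + ε * ∫ τ in t₀..t, ‖u n τ‖| := by
          rw [intervalIntegral.integral_add (by simp) (hui.norm.const_mul ε),
            intervalIntegral.integral_const, intervalIntegral.integral_const_mul, smul_eq_mul,
            mul_comm ε (t - t₀)]
      _ ≤ _ := by
          rw [← mul_add, abs_mul, abs_of_pos hε]
          gcongr
          exact abs_add_le _ _
  rw [hasDerivAt_iff_isLittleO]
  have hQO := hQd.differentiableAt.isBigO_sub
  have e1 : (fun t => z t - z t₀ - (t - t₀) • f t₀ (z t₀) - g t₀ (z t₀) (P t - P t₀))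
      =o[𝓝 t₀] fun t => t - t₀ := by
    -- Differentiability of `Q` turns its increment into O(t - t₀), so the error is o(t - t₀).
    -- Differentiability of `P` alone would not control the mass of the oscillating controls.
    obtain ⟨C, hC, hCb⟩ := hQO.exists_pos
    rw [Asymptotics.isLittleO_iff]
    intro c hc
    filter_upwards [main (c / (1 + C)) (by positivity), hCb.bound] with t h1 h2
    rw [Real.norm_eq_abs, Real.norm_eq_abs] at h2
    refine h1.trans ?_
    calc c / (1 + C) * (|t - t₀| + |Q t - Q t₀|) ≤ c / (1 + C) * (|t - t₀| + C * |t - t₀|) := by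
          gcongr
      _ = c * ‖t - t₀‖ := by rw [Real.norm_eq_abs]; field_simp
  have e2 : (fun t => g t₀ (z t₀) (P t - P t₀ - (t - t₀) • p)) =o[𝓝 t₀] fun t => t - t₀ :=
    ((g t₀ (z t₀)).isBigO_comp _ _).trans_isLittleO (hasDerivAt_iff_isLittleO.1 hPd)
  refine (e1.add e2).congr_left fun t => ?_
  simp only [map_sub, map_smul, smul_add]
  abel

lemma setAverage_Ioc_eq {F : Type*} [NormedAddCommGroup F] [NormedSpace ℝ F] (v : ℝ → F)
    {t h : ℝ} (hh : 0 < h) : ⨍ τ in Ioc t (t + h), v τ = h⁻¹ • ∫ τ in Ioc t (t + h), v τ := by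
  rw [setAverage_eq, Real.volume_real_Ioc_of_le (by linarith), add_sub_cancel_left]

lemma setIntegral_Ioc_eq_sub {F : Type*} [NormedAddCommGroup F] [NormedSpace ℝ F]
    {v : ℝ → F} (hv : IntegrableOn v (Icc 0 T)) {s t : ℝ} (hs : s ∈ Icc 0 T) (ht : t ∈ Icc 0 T)
    (hst : s ≤ t) :
    ∫ τ in Ioc s t, v τ = (∫ τ in (0 : ℝ)..t, v τ) - ∫ τ in (0 : ℝ)..s, v τ := by
  have h0 : (0 : ℝ) ∈ Icc 0 T := ⟨le_rfl, hs.1.trans hs.2⟩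
  rw [intervalIntegral.integral_interval_sub_left (intervalIntegrable_of_Icc hv h0 ht)
    (intervalIntegrable_of_Icc hv h0 hs), intervalIntegral.integral_of_le hst]

lemma eventually_add_mem {t₀ : ℝ} (ht₀ : t₀ ∈ Ioo 0 T) :
    ∀ᶠ h in 𝓝[>] (0 : ℝ), 0 < h ∧ t₀ + h ∈ Icc 0 T := by
  have h1 : ∀ᶠ h in 𝓝[>] (0 : ℝ), h < T - t₀ :=
    nhdsWithin_le_nhds (gt_mem_nhds (by linarith [ht₀.2]))
  filter_upwards [h1, self_mem_nhdsWithin] with h h2 h3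
  have h3 : 0 < h := h3
  exact ⟨h3, by linarith [ht₀.1], by linarith⟩

/-- The derivative of the limit of the primitives takes values in the control set. -/
lemma mem_of_limit {U : Set E} (hU : IsClosed U) (hUc : Convex ℝ U) {u : ℕ → ℝ → E}
    (hu : ∀ n, IntegrableOn (u n) (Icc 0 T))
    (hmem : ∀ n, ∀ᵐ t ∂(volume.restrict (Icc 0 T)), u n t ∈ U) {P : ℝ → E}
    (hP : ∀ t ∈ Icc 0 T, Tendsto (fun n => ∫ τ in (0 : ℝ)..t, u n τ) atTop (𝓝 (P t)))
    {t₀ : ℝ} (ht₀ : t₀ ∈ Ioo 0 T) {p : E} (hPd : HasDerivAt P p t₀) : p ∈ U := by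
  have ht₀' := Ioo_subset_Icc_self ht₀
  refine hU.mem_of_tendsto hPd.tendsto_slope_zero_right ?_
  filter_upwards [eventually_add_mem ht₀] with h ⟨hh, ht⟩
  have hsub : Ioc t₀ (t₀ + h) ⊆ Icc 0 T := fun τ hτ => ⟨ht₀'.1.trans hτ.1.le, hτ.2.trans ht.2⟩
  refine hU.mem_of_tendsto (((hP _ ht).sub (hP _ ht₀')).const_smul h⁻¹)
    (Eventually.of_forall fun n => ?_)
  rw [← setIntegral_Ioc_eq_sub (hu n) ht₀' ht (by linarith), ← setAverage_Ioc_eq _ hh]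
  exact hUc.set_average_mem hU (by simp [hh]) (by simp) (ae_restrict_of_ae_restrict_of_subset hsub (hmem n))
    ((hu n).mono_set hsub)

end Limits

/-! ### Lower semicontinuity of the running cost. -/

section Semicontinuity

variable {E : Type*} [NormedAddCommGroup E] {U : Set E}

/-- The largest `k`-Lipschitz minorant on `E` of a function given on `U`. -/
noncomputable def lipMinorant (U : Set E) (h : E → ℝ) (k : ℝ≥0) (v : E) : ℝ :=
  ⨅ w : U, (h w + k * ‖v - w‖)

lemma lipMinorant_bddBelow {h : E → ℝ} {M : ℝ} (hM : ∀ w ∈ U, M ≤ h w) (k : ℝ≥0) (v : E) :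
    BddBelow (range fun w : U => h w + k * ‖v - w‖) :=
  ⟨M, by
    rintro _ ⟨w, rfl⟩
    have : 0 ≤ (k : ℝ) * ‖v - w‖ := by positivity
    linarith [hM w w.2]⟩

lemma lipMinorant_le {h : E → ℝ} {M : ℝ} (hM : ∀ w ∈ U, M ≤ h w) (k : ℝ≥0) (v : E) {w : E}
    (hw : w ∈ U) : lipMinorant U h k v ≤ h w + k * ‖v - w‖ :=
  ciInf_le (lipMinorant_bddBelow hM k v) ⟨w, hw⟩

lemma lipschitzWith_lipMinorant (hU : U.Nonempty) {h : E → ℝ} {M : ℝ} (hM : ∀ w ∈ U, M ≤ h w)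
    (k : ℝ≥0) : LipschitzWith k (lipMinorant U h k) := by
  have := hU.to_subtype
  refine LipschitzWith.of_le_add_mul k fun v v' => ?_
  rw [← sub_le_iff_le_add]
  refine le_ciInf fun w => ?_
  have h1 := lipMinorant_le hM k v w.2
  have h2 : ‖v - w‖ ≤ dist v v' + ‖v' - w‖ := by
    rw [dist_eq_norm]
    exact norm_sub_le_norm_sub_add_norm_sub v v' w
  have h3 := mul_le_mul_of_nonneg_left h2 k.2
  simp only [NNReal.val_eq_coe] at h3
  linarith

variable [NormedSpace ℝ E]

/-- The convex combination of two ε-optimal competitors lies in `U` and competes for the infimum at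
the combined point. -/
lemma convexOn_lipMinorant {h : E → ℝ} (hh : ConvexOn ℝ U h) (hU : U.Nonempty) {M : ℝ}
    (hM : ∀ w ∈ U, M ≤ h w) (k : ℝ≥0) : ConvexOn ℝ univ (lipMinorant U h k) := by
  have := hU.to_subtype
  refine ⟨convex_univ, fun x _ y _ a b ha hb hab => le_of_forall_pos_le_add fun ε hε => ?_⟩
  obtain ⟨w₁, h1⟩ := exists_lt_of_ciInf_lt (lt_add_of_pos_right (lipMinorant U h k x) hε)
  obtain ⟨w₂, h2⟩ := exists_lt_of_ciInf_lt (lt_add_of_pos_right (lipMinorant U h k y) hε)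
  have h3 := lipMinorant_le hM k (a • x + b • y) (hh.1 w₁.2 w₂.2 ha hb hab)
  have h4 := hh.2 w₁.2 w₂.2 ha hb hab
  have h5 : ‖a • x + b • y - (a • (w₁ : E) + b • (w₂ : E))‖ ≤ a * ‖x - w₁‖ + b * ‖y - w₂‖ := by
    calc _ = ‖a • (x - w₁) + b • (y - w₂)‖ := by congr 1; module
      _ ≤ _ := norm_add_le _ _
      _ = _ := by rw [norm_smul, norm_smul, Real.norm_of_nonneg ha, Real.norm_of_nonneg hb]
  have h6 := mul_le_mul_of_nonneg_left h5 k.2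
  simp only [NNReal.val_eq_coe, smul_eq_mul] at h3 h4 h6 ⊢
  have h7 := mul_le_mul_of_nonneg_left h1.le ha
  have h8 := mul_le_mul_of_nonneg_left h2.le hb
  have h9 : a * ε + b * ε = ε := by rw [← add_mul, hab, one_mul]
  nlinarith

lemma exists_superlinear {C r : ℝ} (hC : 0 < C) (hr : 1 < r) (k m : ℝ) :
    ∃ R, ∀ s, R ≤ s → m + k * s ≤ C * s ^ r := by
  have h1 := (tendsto_rpow_atTop (show 0 < r - 1 by linarith)).eventually_ge_atTop ((k + 1) / C)
  obtain ⟨R, hR⟩ := eventually_atTop.1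
    ((h1.and (eventually_ge_atTop m)).and (eventually_gt_atTop 0))
  refine ⟨R, fun s hs => ?_⟩
  obtain ⟨⟨h2, h3⟩, h4⟩ := hR s hs
  rw [div_le_iff₀ hC] at h2
  have : s ^ r = s ^ (r - 1) * s := by rw [Real.rpow_sub_one h4.ne']; field_simp
  rw [this]
  nlinarith

variable {T Cφ r δ : ℝ} {φ : ℝ → E → E → ℝ} [FiniteDimensional ℝ E]

/-- Near a point, the running cost has a convex Lipschitz minorant, independent of time and state,
which is almost exact at a given control. -/
lemma exists_convex_minorant (hU : IsClosed U)
    (hφ : ContinuousOn (fun z : ℝ × E × E => φ z.1 z.2.1 z.2.2) (Icc 0 T ×ˢ (univ ×ˢ U)))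
    (hconv : ∀ t ∈ Icc 0 T, ∀ x : E, ConvexOn ℝ U (φ t x)) (hC : 0 < Cφ) (hδ : 0 < δ) (hr : 1 < r)
    (hcoer : ∀ t ∈ Icc 0 T, ∀ x : E, ∀ u ∈ U, Cφ * (‖u‖ ^ r - ‖x‖ ^ δ) ≤ φ t x u)
    {t₀ : ℝ} (ht₀ : t₀ ∈ Icc 0 T) (x₀ : E) {p : E} (hp : p ∈ U) {c : ℝ} (hc : c < φ t₀ x₀ p) :
    ∃ (F : E → ℝ) (k : ℝ≥0), LipschitzWith k F ∧ ConvexOn ℝ univ F ∧ c < F p ∧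
      ∃ ρ > 0, ∀ t ∈ Icc 0 T, |t - t₀| < ρ → ∀ x, ‖x - x₀‖ < ρ → ∀ v ∈ U, F v ≤ φ t x v := by
  have hne : U.Nonempty := ⟨p, hp⟩
  have := hne.to_subtype
  set M := -(Cφ * ‖x₀‖ ^ δ) with hMdef
  have hM : ∀ w ∈ U, M ≤ φ t₀ x₀ w := by
    intro w hw
    have h1 := hcoer t₀ ht₀ x₀ w hw
    have h2 : 0 ≤ Cφ * ‖w‖ ^ r := by positivity
    linarith
  have hcw : ∀ w ∈ U, ∀ ε > 0, ∃ η > 0, ∀ t ∈ Icc 0 T, ∀ x, ∀ v ∈ U, |t - t₀| < η →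
      ‖x - x₀‖ < η → ‖v - w‖ < η → |φ t x v - φ t₀ x₀ w| < ε := by
    intro w hw ε hε
    obtain ⟨η, hη, h⟩ := Metric.continuousWithinAt_iff.1
      (hφ (t₀, x₀, w) ⟨ht₀, mem_univ _, hw⟩) ε hε
    refine ⟨η, hη, fun t ht x v hv h1 h2 h3 => ?_⟩
    have := h (x := (t, x, v)) ⟨ht, mem_univ _, hv⟩ (by
      rw [Prod.dist_eq, Prod.dist_eq, dist_eq_norm x, dist_eq_norm v, Real.dist_eq]
      exact max_lt h1 (max_lt h2 h3))
    rwa [Real.dist_eq] at this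
  set c₁ := (c + φ t₀ x₀ p) / 2 with hc1
  obtain ⟨η, hη, hηp⟩ := hcw p hp (φ t₀ x₀ p - c₁) (by rw [hc1]; linarith)
  -- Competitors within η of p cost more than c₁ by continuity. Those farther away pay at least k η,
  -- which this choice of k makes enough to lift the global lower bound M to c₁.
  obtain ⟨k, hk⟩ : ∃ k : ℝ≥0, c₁ ≤ k * η + M := by
    refine ⟨Real.toNNReal ((c₁ - M) / η), ?_⟩
    have h1 : (c₁ - M) / η ≤ Real.toNNReal ((c₁ - M) / η) := Real.le_coe_toNNReal _
    rw [div_le_iff₀ hη] at h1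
    linarith
  set G := lipMinorant U (φ t₀ x₀) k with hG
  have hGp : c₁ ≤ G p := by
    refine le_ciInf fun w => ?_
    by_cases h : ‖(w : E) - p‖ < η
    · have h1 := hηp t₀ ht₀ x₀ w w.2 (by simpa using hη) (by simpa using hη) h
      have h2 := (abs_lt.1 h1).1
      have : 0 ≤ (k : ℝ) * ‖p - w‖ := by positivity
      linarith
    · rw [not_lt, norm_sub_rev] at h
      have h1 := hM w w.2
      have h2 := mul_le_mul_of_nonneg_left h k.2
      simp only [NNReal.val_eq_coe] at h2
      linarith
  set ε := (c₁ - c) / 2 with hε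
  have hε0 : 0 < ε := by rw [hε, hc1]; linarith
  have hlip := lipschitzWith_lipMinorant hne hM k
  refine ⟨fun v => G v - ε, k, ?_, ?_, by simp only; linarith, ?_⟩
  · refine LipschitzWith.of_le_add_mul k fun v v' => ?_
    have := hlip.le_add_mul v v'
    simp only [hG]
    linarith
  · simp only [sub_eq_add_neg]
    exact (convexOn_lipMinorant (hconv t₀ ht₀ x₀) hne hM k).add_const (-ε)
  -- Outside the ball of radius R, coercivity beats the linear upper bound for `G`, uniformly for
  -- ‖x‖ ≤ ‖x₀‖ + 1. Inside, compactness keeps the loss in `φ` caused by moving (t, x) below ε.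
  obtain ⟨R, hR⟩ := exists_superlinear hC hr k
    (φ t₀ x₀ p + k * ‖p‖ + Cφ * (‖x₀‖ + 1) ^ δ)
  have hK : IsCompact (U ∩ Metric.closedBall 0 R) := by
    have := FiniteDimensional.proper_real E
    exact (isCompact_closedBall 0 R).inter_left hU
  have hev : ∀ᶠ z : ℝ × E in 𝓝 (t₀, x₀), ∀ v ∈ U ∩ Metric.closedBall 0 R, z.1 ∈ Icc 0 T → v ∈ U →
      φ t₀ x₀ v - ε < φ z.1 z.2 v := by
    refine hK.eventually_forall_of_forall_eventually fun w hw => ?_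
    obtain ⟨η', hη', h⟩ := hcw w hw.1 (ε / 2) (half_pos hε0)
    refine Metric.eventually_nhds_iff.2 ⟨η', hη', ?_⟩
    rintro ⟨⟨t, x⟩, v⟩ hd ht hv
    rw [Prod.dist_eq, Prod.dist_eq, dist_eq_norm x, dist_eq_norm v, Real.dist_eq] at hd
    simp only [max_lt_iff] at hd
    have h1 := abs_lt.1 (h t ht x v hv hd.1.1 hd.1.2 hd.2)
    have h2 := abs_lt.1 (h t₀ ht₀ x₀ v hv (by simpa using hη') (by simpa using hη') hd.2)
    simp only
    linarith
  obtain ⟨ρ, hρ, hρ'⟩ := Metric.eventually_nhds_iff.1 hev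
  refine ⟨min ρ 1, lt_min hρ one_pos, fun t ht h1 x h2 v hv => ?_⟩
  have hGv := lipMinorant_le hM k v hv
  simp only [sub_self, norm_zero, mul_zero, add_zero] at hGv
  by_cases hvR : ‖v‖ ≤ R
  · have := hρ' (y := (t, x)) (by
      rw [Prod.dist_eq, dist_eq_norm x, Real.dist_eq]
      exact max_lt (h1.trans_le (min_le_left _ _)) (h2.trans_le (min_le_left _ _)))
      v ⟨hv, by simpa using hvR⟩ ht hv
    simp only at this
    linarith
  · have h3 := hR ‖v‖ (not_le.1 hvR).le
    have h4 := hcoer t ht x v hv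
    have h5 : ‖x‖ ^ δ ≤ (‖x₀‖ + 1) ^ δ := by
      refine Real.rpow_le_rpow (norm_nonneg _) ?_ hδ.le
      have := norm_le_norm_add_norm_sub' x x₀
      linarith [h2.trans_le (min_le_right _ _)]
    have h6 := lipMinorant_le hM k v hp
    have h7 : (k : ℝ) * ‖v - p‖ ≤ k * ‖v‖ + k * ‖p‖ := by
      rw [← mul_add]
      exact mul_le_mul_of_nonneg_left (norm_sub_le _ _) k.2
    have h8 := mul_le_mul_of_nonneg_left h5 hC.le
    linarith

/-- Averages over `(t, t + h]` preserve the integral. -/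
lemma lintegral_average {G : ℝ → ℝ≥0∞} (hG : Measurable G) {h : ℝ} (hh : 0 < h) :
    Measurable (fun t => (ENNReal.ofReal h)⁻¹ * ∫⁻ s in Ioc t (t + h), G s) ∧
      ∫⁻ t, (ENNReal.ofReal h)⁻¹ * ∫⁻ s in Ioc t (t + h), G s = ∫⁻ t, G t := by
  have e : ∀ t, ∫⁻ s in Ioc t (t + h), G s = ∫⁻ s in Ioc 0 h, G (t + s) := by
    intro t
    have h1 := (measurePreserving_add_left volume t).setLIntegral_comp_preimage
      (s := Ioc t (t + h)) measurableSet_Ioc hG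
    rw [← h1]
    congr 2
    ext s
    simp
  have hm : Measurable (Function.uncurry fun t s : ℝ => G (t + s)) :=
    hG.comp (measurable_fst.add measurable_snd)
  have hm' : Measurable fun t => ∫⁻ s in Ioc 0 h, G (t + s) := hm.lintegral_prod_right'
  simp only [e]
  refine ⟨hm'.const_mul _, ?_⟩
  rw [lintegral_const_mul _ hm', lintegral_lintegral_swap hm.aemeasurable]
  simp only [lintegral_add_right_eq_self, lintegral_const, Measure.restrict_apply_univ,
    Real.volume_Ioc, sub_zero]
  rw [mul_comm (∫⁻ t, G t), ← mul_assoc, ENNReal.inv_mul_cancel (by simpa using hh)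
    ENNReal.ofReal_ne_top, one_mul]

/-- The negative part is dropped, so no sign condition is needed; the shifted minorant in the Jensen
step may be negative. -/
lemma ofReal_integral_le {α : Type*} [MeasurableSpace α] {μ : Measure α} {v : α → ℝ}
    (hv : Integrable v μ) : ENNReal.ofReal (∫ t, v t ∂μ) ≤ ∫⁻ t, ENNReal.ofReal (v t) ∂μ := by
  rw [integral_eq_lintegral_pos_part_sub_lintegral_neg_part hv]
  refine ENNReal.ofReal_le_of_le_toReal ?_
  linarith [ENNReal.toReal_nonneg (a := ∫⁻ t, ENNReal.ofReal (-v t) ∂μ)]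

/-- Lower bound for the averaged running costs at a point of differentiability. -/
lemma eventually_le_liminf_average (hU : IsClosed U)
    (hφ : ContinuousOn (fun z : ℝ × E × E => φ z.1 z.2.1 z.2.2) (Icc 0 T ×ˢ (univ ×ˢ U)))
    (hconv : ∀ t ∈ Icc 0 T, ∀ x : E, ConvexOn ℝ U (φ t x)) (hC : 0 < Cφ) (hδ : 0 < δ) (hr : 1 < r)
    (hcoer : ∀ t ∈ Icc 0 T, ∀ x : E, ∀ u ∈ U, Cφ * (‖u‖ ^ r - ‖x‖ ^ δ) ≤ φ t x u)
    {x u : ℕ → ℝ → E} (hu : ∀ n, IntegrableOn (u n) (Icc 0 T))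
    (hmem : ∀ n, ∀ᵐ t ∂(volume.restrict (Icc 0 T)), u n t ∈ U)
    {z : ℝ → E} (hz : Continuous z) (hxz : TendstoUniformlyOn x z atTop (Icc 0 T)) {P : ℝ → E}
    (hP : ∀ t ∈ Icc 0 T, Tendsto (fun n => ∫ τ in (0 : ℝ)..t, u n τ) atTop (𝓝 (P t)))
    {t₀ : ℝ} (ht₀ : t₀ ∈ Ioo 0 T) {p : E} (hp : p ∈ U) (hPd : HasDerivAt P p t₀)
    (C₀ : ℝ) {c : ℝ} (hc : c < φ t₀ (z t₀) p) :
    ∀ᶠ h in 𝓝[>] (0 : ℝ), ENNReal.ofReal (c + C₀) ≤ liminf (fun n => (ENNReal.ofReal h)⁻¹ *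
      ∫⁻ s in Ioc t₀ (t₀ + h), ENNReal.ofReal (φ s (x n s) (u n s) + C₀)) atTop := by
  have ht₀' := Ioo_subset_Icc_self ht₀
  obtain ⟨F, k, hFl, hFc, hcF, ρ, hρ, hF⟩ :=
    exists_convex_minorant hU hφ hconv hC hδ hr hcoer ht₀' (z t₀) hp hc
  obtain ⟨η, hη, hηz⟩ := Metric.continuousAt_iff.1 hz.continuousAt (ρ / 2) (half_pos hρ)
  have hsm : ∀ᶠ h in 𝓝[>] (0 : ℝ), h < min ρ η :=
    nhdsWithin_le_nhds (gt_mem_nhds (lt_min hρ hη))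
  have hsl := (hFl.continuous.tendsto p).comp hPd.tendsto_slope_zero_right
  filter_upwards [eventually_add_mem ht₀, hsm, hsl.eventually (lt_mem_nhds hcF)] with
    h ⟨hh, ht⟩ hhs hslope
  have hsub : Ioc t₀ (t₀ + h) ⊆ Icc 0 T := fun τ hτ => ⟨ht₀'.1.trans hτ.1.le, hτ.2.trans ht.2⟩
  have hlim := (hFl.continuous.tendsto _).comp
    (((hP _ ht).sub (hP _ ht₀')).const_smul h⁻¹)
  refine le_liminf_of_le (by isBoundedDefault) ?_
  filter_upwards [hlim.eventually (lt_mem_nhds hslope),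
    Metric.tendstoUniformlyOn_iff.1 hxz (ρ / 2) (half_pos hρ)] with n hn1 hn2
  simp only [Function.comp_apply] at hn1
  rw [← setIntegral_Ioc_eq_sub (hu n) ht₀' ht (by linarith), ← setAverage_Ioc_eq _ hh] at hn1
  have hui : IntegrableOn (u n) (Ioc t₀ (t₀ + h)) := (hu n).mono_set hsub
  have hFi : IntegrableOn (F ∘ u n) (Ioc t₀ (t₀ + h)) := by
    refine Integrable.mono' ((hui.norm.const_mul (k : ℝ)).add
      (integrable_const (‖F 0‖) : IntegrableOn (fun _ => ‖F 0‖) (Ioc t₀ (t₀ + h))))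
      (hFl.continuous.comp_aestronglyMeasurable hui.aestronglyMeasurable)
      (Eventually.of_forall fun s => ?_)
    have h1 := hFl.dist_le_mul (u n s) 0
    rw [dist_eq_norm, dist_zero_right] at h1
    have h2 := norm_le_norm_add_norm_sub' (F (u n s)) (F 0)
    simp only [Function.comp_apply, Pi.add_apply]
    linarith
  have hjen := hFc.map_set_average_le hFl.continuous.continuousOn isClosed_univ
    (μ := volume) (t := Ioc t₀ (t₀ + h)) (by simp [hh]) (by simp) (by simp) hui hFi
  have hFi' : Integrable (fun s => F (u n s) + C₀) (volume.restrict (Ioc t₀ (t₀ + h))) :=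
    hFi.add (integrable_const _)
  calc ENNReal.ofReal (c + C₀) ≤ ENNReal.ofReal (h⁻¹ * ∫ s in Ioc t₀ (t₀ + h), (F (u n s) + C₀)) := by
        refine ENNReal.ofReal_le_ofReal ?_
        rw [integral_add (f := fun s => F (u n s)) hFi (integrable_const _), setIntegral_const,
          Real.volume_real_Ioc_of_le (by linarith), mul_add, add_sub_cancel_left, smul_eq_mul,
          inv_mul_cancel_left₀ hh.ne', ← smul_eq_mul, ← setAverage_Ioc_eq _ hh]
        linarith
    _ = (ENNReal.ofReal h)⁻¹ * ENNReal.ofReal (∫ s in Ioc t₀ (t₀ + h), (F (u n s) + C₀)) := by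
        rw [ENNReal.ofReal_mul (by positivity), ENNReal.ofReal_inv_of_pos hh]
    _ ≤ (ENNReal.ofReal h)⁻¹ * ∫⁻ s in Ioc t₀ (t₀ + h), ENNReal.ofReal (F (u n s) + C₀) := by
        gcongr
        exact ofReal_integral_le hFi'
    _ ≤ _ := by
        gcongr 1
        refine lintegral_mono_ae ?_
        filter_upwards [ae_restrict_of_ae_restrict_of_subset hsub (hmem n),
          ae_restrict_mem measurableSet_Ioc] with s hs1 hs2
        refine ENNReal.ofReal_le_ofReal ?_
        have hst : |s - t₀| < min ρ η := by
          rw [abs_of_nonneg (by linarith [hs2.1])]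
          linarith [hs2.2]
        have h1 := hF s (hsub hs2) (hst.trans_le (min_le_left _ _)) (x n s) (by
          rw [← dist_eq_norm]
          calc dist (x n s) (z t₀) ≤ dist (x n s) (z s) + dist (z s) (z t₀) := dist_triangle _ _ _
            _ < ρ / 2 + ρ / 2 := by
                refine add_lt_add ?_ (hηz ?_)
                · rw [dist_comm]; exact hn2 s (hsub hs2)
                · rw [Real.dist_eq]
                  exact hst.trans_le (min_le_right _ _)
            _ = ρ := add_halves ρ) (u n s) hs1
        linarith

/-- Lower semicontinuity of the running costs. -/
lemma lintegral_le_liminf_lintegral (hU : IsClosed U) (hUc : Convex ℝ U)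
    (hφ : ContinuousOn (fun z : ℝ × E × E => φ z.1 z.2.1 z.2.2) (Icc 0 T ×ˢ (univ ×ˢ U)))
    (hconv : ∀ t ∈ Icc 0 T, ∀ x : E, ConvexOn ℝ U (φ t x)) (hC : 0 < Cφ) (hδ : 0 < δ) (hr : 1 < r)
    (hcoer : ∀ t ∈ Icc 0 T, ∀ x : E, ∀ u ∈ U, Cφ * (‖u‖ ^ r - ‖x‖ ^ δ) ≤ φ t x u)
    {x u : ℕ → ℝ → E} (hu : ∀ n, IntegrableOn (u n) (Icc 0 T))
    (hmem : ∀ n, ∀ᵐ t ∂(volume.restrict (Icc 0 T)), u n t ∈ U)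
    (hmeas : ∀ n, AEMeasurable (fun t => φ t (x n t) (u n t)) (volume.restrict (Icc 0 T)))
    {z : ℝ → E} (hz : Continuous z) (hxz : TendstoUniformlyOn x z atTop (Icc 0 T)) {P : ℝ → E}
    (hP : ∀ t ∈ Icc 0 T, Tendsto (fun n => ∫ τ in (0 : ℝ)..t, u n τ) atTop (𝓝 (P t)))
    (hPd : ∀ᵐ t ∂(volume.restrict (Icc 0 T)), DifferentiableAt ℝ P t) (C₀ : ℝ) :
    ∫⁻ t in Icc 0 T, ENNReal.ofReal (φ t (z t) (deriv P t) + C₀) ≤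
      liminf (fun n => ∫⁻ t in Icc 0 T, ENNReal.ofReal (φ t (x n t) (u n t) + C₀)) atTop := by
  let Φ : ℕ → ℝ → ℝ≥0∞ := fun n t => ENNReal.ofReal (φ t (x n t) (u n t) + C₀)
  have hΦ : ∀ n, AEMeasurable ((Icc 0 T).indicator (Φ n)) :=
    fun n => (aemeasurable_indicator_iff measurableSet_Icc).2
      (((hmeas n).add_const C₀).ennreal_ofReal)
  -- Extension by zero and a measurable version put the costs on the whole line, where averaging
  -- over translates preserves the integral.
  let G : ℕ → ℝ → ℝ≥0∞ := fun n => (hΦ n).mk _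
  have hG : ∀ n, Measurable (G n) := fun n => (hΦ n).measurable_mk
  have hGe : ∀ n, (Icc 0 T).indicator (Φ n) =ᵐ[volume] G n := fun n => (hΦ n).ae_eq_mk
  let h : ℕ → ℝ := fun k => 1 / ((k : ℝ) + 1)
  have hh : ∀ k, 0 < h k := fun k => Nat.one_div_pos_of_nat
  have hht : Tendsto h atTop (𝓝[>] 0) :=
    tendsto_nhdsWithin_iff.2 ⟨tendsto_one_div_add_atTop_nhds_zero_nat, Eventually.of_forall hh⟩
  let S : ℕ → ℕ → ℝ → ℝ≥0∞ := fun k n t =>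
    (ENNReal.ofReal (h k))⁻¹ * ∫⁻ s in Ioc t (t + h k), G n s
  have hSm : ∀ k n, Measurable (S k n) := fun k n => (lintegral_average (hG n) (hh k)).1
  have hSi : ∀ k n, ∫⁻ t, S k n t = ∫⁻ t in Icc 0 T, Φ n t := by
    intro k n
    rw [(lintegral_average (hG n) (hh k)).2, ← lintegral_indicator measurableSet_Icc]
    exact (lintegral_congr_ae (hGe n)).symm
  -- Only n → ∞ with the window `h k` fixed, followed by k → ∞, gives a pointwise bound, because the
  -- costs themselves need not converge pointwise. Fatou's lemma is then applied in the same two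
  -- variables.
  have hpt : ∀ᵐ t ∂(volume.restrict (Icc 0 T)),
      ENNReal.ofReal (φ t (z t) (deriv P t) + C₀) ≤
        liminf (fun k => liminf (fun n => S k n t) atTop) atTop := by
    rw [← restrict_Ioo_eq_restrict_Icc] at hPd ⊢
    filter_upwards [hPd, ae_restrict_mem measurableSet_Ioo] with t hd ht
    have hp := mem_of_limit hU hUc hu hmem hP ht hd.hasDerivAt
    have hcont : Tendsto (fun c => ENNReal.ofReal (c + C₀)) (𝓝[<] (φ t (z t) (deriv P t)))
        (𝓝 (ENNReal.ofReal (φ t (z t) (deriv P t) + C₀))) :=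
      ((ENNReal.continuous_ofReal.comp (continuous_id.add continuous_const)).tendsto _).mono_left
        nhdsWithin_le_nhds
    refine le_of_tendsto hcont ?_
    filter_upwards [self_mem_nhdsWithin] with c hc
    refine le_liminf_of_le (by isBoundedDefault) ?_
    have h1 := hht.eventually (eventually_le_liminf_average hU hφ hconv hC hδ hr hcoer hu hmem hz hxz
      hP ht hp hd.hasDerivAt C₀ hc)
    filter_upwards [h1, hht.eventually (eventually_add_mem ht)] with k hk1 hk2
    refine hk1.trans (le_of_eq ?_)
    congr 1
    funext n
    simp only [S]
    congr 1
    refine lintegral_congr_ae ?_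
    filter_upwards [ae_restrict_of_ae (hGe n), ae_restrict_mem measurableSet_Ioc] with s hs1 hs2
    rw [← hs1, indicator_of_mem (show s ∈ Icc 0 T from
      ⟨ht.1.le.trans hs2.1.le, hs2.2.trans hk2.2.2⟩)]
  calc _ ≤ ∫⁻ t in Icc 0 T, liminf (fun k => liminf (fun n => S k n t) atTop) atTop :=
        lintegral_mono_ae hpt
    _ ≤ ∫⁻ t, liminf (fun k => liminf (fun n => S k n t) atTop) atTop :=
        setLIntegral_le_lintegral _ _
    _ ≤ liminf (fun k => ∫⁻ t, liminf (fun n => S k n t) atTop) atTop :=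
        lintegral_liminf_le fun k => Measurable.liminf (hSm k)
    _ ≤ liminf (fun _ : ℕ => liminf (fun n => ∫⁻ t in Icc 0 T, Φ n t) atTop) atTop := by
        refine liminf_le_liminf (Eventually.of_forall fun k => ?_)
        refine (lintegral_liminf_le (hSm k)).trans (le_of_eq ?_)
        simp only [hSi]
    _ = _ := liminf_const _

end Semicontinuity

/-! ### Polynomial growth of the a priori bounds. -/

section Growth

/-- `h` is nonnegative and grows at most like the power `s` on `[0, ∞)`. -/
def PolyBound (s : ℝ) (h : ℝ → ℝ) : Prop :=
  ∃ C, 0 ≤ C ∧ ∀ N, 0 ≤ N → 0 ≤ h N ∧ h N ≤ C * (1 + N) ^ s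

namespace PolyBound

variable {s s' : ℝ} {h h' : ℝ → ℝ}

lemma const {c : ℝ} (hc : 0 ≤ c) : PolyBound 0 fun _ => c :=
  ⟨c, hc, fun N _ => ⟨hc, by simp⟩⟩

lemma rpow_self (hs : 0 ≤ s) : PolyBound s fun N => N ^ s :=
  ⟨1, zero_le_one, fun N hN => ⟨by positivity, by
    rw [one_mul]; exact Real.rpow_le_rpow hN (by linarith) hs⟩⟩

lemma mono (hh : PolyBound s h) (hs : s ≤ s') : PolyBound s' h := by
  obtain ⟨C, hC, H⟩ := hh
  refine ⟨C, hC, fun N hN => ⟨(H N hN).1, (H N hN).2.trans ?_⟩⟩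
  gcongr
  linarith

lemma add (hh : PolyBound s h) (hh' : PolyBound s h') : PolyBound s fun N => h N + h' N := by
  obtain ⟨C, hC, H⟩ := hh
  obtain ⟨C', hC', H'⟩ := hh'
  refine ⟨C + C', add_nonneg hC hC', fun N hN => ⟨add_nonneg (H N hN).1 (H' N hN).1, ?_⟩⟩
  rw [add_mul]
  exact add_le_add (H N hN).2 (H' N hN).2

lemma mul (hh : PolyBound s h) (hh' : PolyBound s' h') :
    PolyBound (s + s') fun N => h N * h' N := by
  obtain ⟨C, hC, H⟩ := hh
  obtain ⟨C', hC', H'⟩ := hh'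
  refine ⟨C * C', mul_nonneg hC hC', fun N hN => ⟨mul_nonneg (H N hN).1 (H' N hN).1, ?_⟩⟩
  have h1 := (H N hN).1
  calc h N * h' N ≤ (C * (1 + N) ^ s) * (C' * (1 + N) ^ s') := by
        gcongr
        · exact (H' N hN).1
        · exact (H N hN).2
        · exact (H' N hN).2
    _ = C * C' * (1 + N) ^ (s + s') := by rw [Real.rpow_add (by linarith)]; ring

lemma const_mul (hh : PolyBound s h) {c : ℝ} (hc : 0 ≤ c) : PolyBound s fun N => c * h N := by
  simpa using (const hc).mul hh

lemma rpow (hh : PolyBound s h) {a : ℝ} (ha : 0 ≤ a) : PolyBound (s * a) fun N => h N ^ a := by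
  obtain ⟨C, hC, H⟩ := hh
  refine ⟨C ^ a, by positivity, fun N hN => ⟨Real.rpow_nonneg (H N hN).1 a, ?_⟩⟩
  rw [Real.rpow_mul (by linarith), ← Real.mul_rpow hC (by positivity)]
  exact Real.rpow_le_rpow (H N hN).1 (H N hN).2 ha

lemma le_small (hh : PolyBound s h) {r : ℝ} (hr : 0 < r) (hsr : s < r) {ε : ℝ} (hε : 0 < ε) :
    ∃ C, ∀ N, 0 ≤ N → h N ≤ ε * N ^ r + C := by
  -- A nonnegative exponent makes the bound monotone in N; it stays below r because r is positive.
  obtain ⟨C, hC, H⟩ := hh.mono (le_max_left s 0)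
  set q := max s 0 with hq
  have hq0 : 0 ≤ q := le_max_right _ _
  have hqr : q < r := max_lt hsr hr
  have h1 := (tendsto_rpow_atTop (show 0 < r - q by linarith)).eventually_ge_atTop (C * 2 ^ q / ε)
  obtain ⟨N₀, hN₀⟩ := eventually_atTop.1 (h1.and (eventually_ge_atTop 1))
  have hN1 : 1 ≤ max N₀ 1 := le_max_right _ _
  refine ⟨C * (1 + max N₀ 1) ^ q, fun N hN => (H N hN).2.trans ?_⟩
  rcases le_total N (max N₀ 1) with h | h
  · have : 0 ≤ ε * N ^ r := by positivity
    have h2 : C * (1 + N) ^ q ≤ C * (1 + max N₀ 1) ^ q := by gcongr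
    linarith
  · obtain ⟨h2, h3⟩ := hN₀ N ((le_max_left _ _).trans h)
    rw [div_le_iff₀ hε] at h2
    have h4 : C * (1 + N) ^ q ≤ ε * N ^ r := by
      calc C * (1 + N) ^ q ≤ C * (2 * N) ^ q := by gcongr; linarith
        _ = C * 2 ^ q * N ^ q := by rw [Real.mul_rpow two_pos.le hN]; ring
        _ ≤ N ^ (r - q) * ε * N ^ q := by gcongr
        _ = ε * N ^ r := by
            rw [Real.rpow_sub (by linarith)]
            field_simp
    have : 0 ≤ C * (1 + max N₀ 1) ^ q := by positivity
    linarith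

end PolyBound

/-- The bound on the state for a control of norm `N`. -/
noncomputable def stateBound (γ Ce N : ℝ) : ℝ := Ce * (1 + N ^ γ)

/-- A positive bound on the norm of the speed for a control of norm `N`. -/
noncomputable def speedBound (β Cs N : ℝ) : ℝ := Cs * (1 + N ^ β) + 1

/-- The bound on the Hölder constant of the observation function along the state, with exponent `a`
and with respect to normalised arc length, for a control of norm `N`. -/
noncomputable def holderBound (T κ a α β γ Cψ Cs Ce N : ℝ) : ℝ :=
  Cψ * (1 + stateBound γ Ce N ^ α) * (T + 2 * stateBound γ Ce N) ^ (κ - a) *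
    (T + (T + 1) * speedBound β Cs N) ^ a

variable {T κ a α β γ Cψ Cs Ce : ℝ}

lemma polyBound_stateBound (hγ : 0 ≤ γ) (hCe : 0 ≤ Ce) : PolyBound γ (stateBound γ Ce) :=
  (((PolyBound.const zero_le_one).mono hγ).add (.rpow_self hγ)).const_mul hCe

lemma polyBound_speedBound (hβ : 0 ≤ β) (hCs : 0 ≤ Cs) : PolyBound β (speedBound β Cs) :=
  ((((PolyBound.const zero_le_one).mono hβ).add (.rpow_self hβ)).const_mul hCs).add
    ((PolyBound.const zero_le_one).mono hβ)

/-- The three exponents come from the Hölder constant on the ball containing the state, from the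
diameter of its graph to the power κ - a, and from the length of its graph to the power a. -/
lemma polyBound_holderBound (hT : 0 ≤ T) (ha : 0 ≤ a) (haκ : a ≤ κ) (hα : 0 ≤ α) (hβ : 0 ≤ β)
    (hγ : 0 ≤ γ) (hCψ : 0 ≤ Cψ) (hCs : 0 ≤ Cs) (hCe : 0 ≤ Ce) :
    PolyBound (γ * α + γ * (κ - a) + β * a) (holderBound T κ a α β γ Cψ Cs Ce) := by
  have h1 := polyBound_stateBound hγ hCe
  have h2 := polyBound_speedBound hβ hCs
  have e1 := (((PolyBound.const zero_le_one).mono (mul_nonneg hγ hα)).add (h1.rpow hα)).const_mul hCψ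
  have e2 := (((PolyBound.const hT).mono hγ).add (h1.const_mul two_pos.le)).rpow
    (sub_nonneg.2 haκ)
  have e3 := (((PolyBound.const hT).mono hβ).add
    (h2.const_mul (show 0 ≤ T + 1 by linarith))).rpow ha
  exact (e1.mul e2).mul e3

end Growth

/-! ### L^r norms as integrals. -/

section Norms

variable {E : Type*} [NormedAddCommGroup E] {r T : ℝ}

lemma norm_rpow_of_memLp (hr : 1 < r) {v : ℝ → E}
    (hv : MemLp v (ENNReal.ofReal r) (volume.restrict (Icc 0 T))) :
    IntegrableOn v (Icc 0 T) ∧ IntegrableOn (fun t => ‖v t‖ ^ r) (Icc 0 T) ∧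
      ∫ t in Icc 0 T, ‖v t‖ ^ r = (lrNorm r T v).toReal ^ r := by
  have hr0 : 0 < r := by linarith
  have h0 : ENNReal.ofReal r ≠ 0 := by simpa using hr0
  have h1 : (1 : ℝ≥0∞) ≤ ENNReal.ofReal r := by simpa using hr.le
  have e : (ENNReal.ofReal r).toReal = r := ENNReal.toReal_ofReal hr0.le
  refine ⟨hv.integrable h1, ?_, ?_⟩
  · have := hv.integrable_norm_rpow h0 ENNReal.ofReal_ne_top
    rwa [e] at this
  · have hnn : 0 ≤ ∫ t in Icc 0 T, ‖v t‖ ^ r := integral_nonneg fun t => by positivity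
    rw [lrNorm, hv.eLpNorm_eq_integral_rpow_norm h0 ENNReal.ofReal_ne_top, e,
      ENNReal.toReal_ofReal (by positivity), Real.rpow_inv_rpow hnn hr0.ne']

lemma HasSpeed.setIntegral_le {F : Type*} [NormedAddCommGroup F] {Y : ℝ} (hT : 0 ≤ T) (hr : 1 < r)
    (hY : 0 < Y) {x : ℝ → F} {v : ℝ → ℝ} (h : HasSpeed r T (Y ^ r) x v) :
    ∫ t in Icc 0 T, v t ≤ (T + 1) * Y := by
  have hi0 : IntegrableOn (fun _ : ℝ => Y) (Icc 0 T) := integrableOn_const (by simp)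
  calc ∫ t in Icc 0 T, v t ≤ ∫ t in Icc 0 T, (Y + Y ^ (1 - r) * v t ^ r) :=
        setIntegral_mono h.integrable (hi0.add (h.integrable_rpow.const_mul _))
          fun t => le_add_rpow hr.le hY (h.nonneg t)
    _ = T * Y + Y ^ (1 - r) * ∫ t in Icc 0 T, v t ^ r := by
        rw [integral_add hi0 (h.integrable_rpow.const_mul _), integral_const_mul,
          setIntegral_const, smul_eq_mul, Real.volume_real_Icc_of_le hT, sub_zero]
    _ ≤ T * Y + Y ^ (1 - r) * Y ^ r := by
        gcongr
        exact h.integral_rpow_le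
    _ = (T + 1) * Y := by rw [← Real.rpow_add hY]; simp; ring

end Norms

/-! ### A priori estimates along processes. -/

section Processes

variable {E : Type*} [NormedAddCommGroup E] [NormedSpace ℝ E] [MeasurableSpace E] {d : ℕ} {T : ℝ}
  {f : ℝ → E → E} {g : ℝ → E → E →L[ℝ] E} {U : Set E}
  {φ : ℝ → E → E → ℝ} {ψ : ℝ → E → EuclideanSpace ℝ (Fin d) →L[ℝ] ℝ} {ξ : E}
  {r : ℝ} {κ : ℝ≥0} {α β γ δ Cφ Cψ Cs Ce : ℝ}

lemma IsProcess.continuousOn (hT : 0 ≤ T) {x u : ℝ → E} (h : IsProcess f g T ξ x u) :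
    ContinuousOn x (Icc 0 T) := by
  simpa only [uIcc_of_le hT] using h.absolutelyContinuous.continuousOn

/-- Hölder continuity of the observation function along the state with respect to a normalised
control, whose modulus of continuity depends only on the bounds for the speed. -/
lemma exists_holder_control (hT : 0 < T)
    (hyp : ExistenceHypothesis f g U φ ψ T ξ r κ α β γ δ Cφ Cψ Cs Ce) {a : ℝ} (ha : 0 < a)
    (haκ : a ≤ κ) {x : ℝ → E} {v : ℝ → ℝ} {M : ℝ} (hM : 0 ≤ M)
    (hv : HasSpeed r T (speedBound β Cs M ^ r) x v)
    (hx : ∀ t ∈ Icc 0 T, ‖x t‖ ≤ stateBound γ Ce M) :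
    ∃ w : ℝ → ℝ, MonotoneOn w (Icc 0 T) ∧ ContinuousOn w (Icc 0 T) ∧ w T - w 0 ≤ 1 ∧
      (∀ s ∈ Icc 0 T, ∀ t ∈ Icc 0 T, s ≤ t →
        w t - w s ≤ (t - s + ∫ τ in Ioc s t, v τ) / T) ∧
      ∀ s ∈ Icc 0 T, ∀ t ∈ Icc 0 T, s ≤ t →
        ‖ψ t (x t) - ψ s (x s)‖ ≤ holderBound T κ a α β γ Cψ Cs Ce M * (w t - w s) ^ a := by
  have h0 : (0 : ℝ) ∈ Icc 0 T := ⟨le_rfl, hT.le⟩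
  have hTT : T ∈ Icc 0 T := ⟨hT.le, le_rfl⟩
  have hCe := hyp.Ce_nonneg
  have hCs := hyp.Cs_nonneg
  have hCψ := hyp.Cpsi_nonneg
  have hR0 : 0 ≤ stateBound γ Ce M := by unfold stateBound; positivity
  have hY0 : 0 < speedBound β Cs M := by unfold speedBound; positivity
  have hvnn : ∀ s t, 0 ≤ ∫ τ in Ioc s t, v τ := fun s t => integral_nonneg hv.nonneg
  -- L bounds the length of the graph of x, and w is this length parameter divided by L. Since T ≤
  -- L, the modulus of continuity of w depends only on that of the integrals of v.
  set L := T + ∫ τ in Ioc 0 T, v τ with hL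
  have hTL : T ≤ L := by linarith [hvnn 0 T]
  have hL0 : 0 < L := hT.trans_le hTL
  have hLle : L ≤ T + (T + 1) * speedBound β Cs M := by
    have := hv.setIntegral_le hT.le hyp.r_gt hY0
    rw [integral_Icc_eq_integral_Ioc] at this
    linarith
  let w : ℝ → ℝ := fun t => (t + ∫ τ in (0 : ℝ)..t, v τ) / L
  have hw : ∀ s ∈ Icc 0 T, ∀ t ∈ Icc 0 T, s ≤ t →
      w t - w s = (t - s + ∫ τ in Ioc s t, v τ) / L := by
    intro s hs t ht hst
    rw [setIntegral_Ioc_eq_sub hv.integrable hs ht hst]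
    simp only [w]
    ring
  refine ⟨w, ?_, ?_, ?_, ?_, ?_⟩
  · intro s hs t ht hst
    rw [← sub_nonneg, hw s hs t ht hst]
    exact div_nonneg (by linarith [hvnn s t]) hL0.le
  · refine ContinuousOn.div_const (continuousOn_id.add ?_) _
    have := intervalIntegral.continuousOn_primitive_interval (μ := volume) (f := v) (a := 0) (b := T)
      (by rw [uIcc_of_le hT.le]; exact hv.integrable)
    rwa [uIcc_of_le hT.le] at this
  · rw [hw 0 h0 T hTT hT.le, sub_zero, ← hL, div_self hL0.ne']
  · intro s hs t ht hst
    rw [hw s hs t ht hst]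
    have : 0 ≤ t - s + ∫ τ in Ioc s t, v τ := by linarith [hvnn s t]
    gcongr
  · intro s hs t ht hst
    obtain ⟨K, hK, hH⟩ := hyp.holder _ hR0
    have h1 := hH.dist_le (x := (t, x t)) (y := (s, x s)) ⟨ht, hx t ht⟩ ⟨hs, hx s hs⟩
    rw [dist_eq_norm] at h1
    have hm0 : 0 ≤ t - s + ∫ τ in Ioc s t, v τ := by linarith [hvnn s t]
    have hd1 : dist (t, x t) (s, x s) ≤ t - s + ∫ τ in Ioc s t, v τ := by
      rw [Prod.dist_eq, Real.dist_eq, dist_eq_norm, abs_of_nonneg (by linarith)]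
      exact max_le (by linarith [hvnn s t]) (by linarith [hv.le s hs t ht hst])
    have hd2 : dist (t, x t) (s, x s) ≤ T + 2 * stateBound γ Ce M := by
      rw [Prod.dist_eq, Real.dist_eq, dist_eq_norm, abs_of_nonneg (by linarith)]
      refine max_le (by linarith [hs.1, ht.2]) ?_
      linarith [norm_sub_le (x t) (x s), hx t ht, hx s hs]
    set D := dist (t, x t) (s, x s)
    have hD0 : 0 ≤ D := dist_nonneg
    -- Interpolation: the first factor is bounded by the diameter, hence by the state bound, and
    -- only the second by arc length, hence by the speed bound.
    have hsplit : D ^ (κ : ℝ) = D ^ ((κ : ℝ) - a) * D ^ a := by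
      rw [← Real.rpow_add_of_nonneg hD0 (by linarith) ha.le]; ring_nf
    calc ‖ψ t (x t) - ψ s (x s)‖ ≤ K * D ^ (κ : ℝ) := h1
      _ = K * (D ^ ((κ : ℝ) - a) * D ^ a) := by rw [hsplit]
      _ ≤ Cψ * (1 + stateBound γ Ce M ^ α) * ((T + 2 * stateBound γ Ce M) ^ ((κ : ℝ) - a) *
            (L * (w t - w s)) ^ a) := by
          have h2 : D ≤ L * (w t - w s) := by
            rw [hw s hs t ht hst, mul_div_cancel₀ _ hL0.ne']
            exact hd1
          have h3 : 0 ≤ (κ : ℝ) - a := by linarith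
          gcongr
      _ = Cψ * (1 + stateBound γ Ce M ^ α) * (T + 2 * stateBound γ Ce M) ^ ((κ : ℝ) - a) *
            (L ^ a * (w t - w s) ^ a) := by
          rw [Real.mul_rpow hL0.le (by rw [hw s hs t ht hst]; positivity)]
          ring
      _ ≤ _ := by
          have h3 : 0 ≤ w t - w s := by rw [hw s hs t ht hst]; positivity
          unfold holderBound
          rw [mul_assoc _ (_ ^ a) (_ ^ a)]
          gcongr

lemma holderBound_nonneg (hT : 0 < T)
    (hyp : ExistenceHypothesis f g U φ ψ T ξ r κ α β γ δ Cφ Cψ Cs Ce) (a : ℝ) {M : ℝ} (hM : 0 ≤ M) :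
    0 ≤ holderBound T κ a α β γ Cψ Cs Ce M := by
  have hCe := hyp.Ce_nonneg
  have hCs := hyp.Cs_nonneg
  have hCψ := hyp.Cpsi_nonneg
  unfold holderBound stateBound speedBound
  positivity

/-- One fine enough dissection with left tags is close to both values. This identifies the integral
in any `HasCost` with the one for which estimates are known. -/
lemma HasYoungIntegral.unique {V W : Type*} [NormedAddCommGroup V] [NormedSpace ℝ V]
    [NormedAddCommGroup W] [NormedSpace ℝ W] (hT : 0 < T) {x : ℝ → V →L[ℝ] W} {y : ℝ → V}
    {J J' : W} (h : HasYoungIntegral T x y J) (h' : HasYoungIntegral T x y J') : J = J' := by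
  refine eq_of_forall_dist_le fun ε hε => ?_
  obtain ⟨δ₁, hδ₁, h1⟩ := h (ε / 2) (half_pos hε)
  obtain ⟨δ₂, hδ₂, h2⟩ := h' (ε / 2) (half_pos hε)
  obtain ⟨D, hD⟩ := Dissection.exists_mesh_lt hT (lt_min hδ₁ hδ₂)
  have e1 := h1 D (fun i hi => (hD i hi).trans_le (min_le_left _ _)) D.t
    fun i hi => ⟨le_rfl, (D.lt i hi).le⟩
  have e2 := h2 D (fun i hi => (hD i hi).trans_le (min_le_right _ _)) D.t
    fun i hi => ⟨le_rfl, (D.lt i hi).le⟩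
  rw [← dist_eq_norm] at e1 e2
  rw [dist_comm] at e1
  linarith [dist_triangle J (∑ i ∈ Finset.range D.n, x (D.t i) (y (D.t (i + 1)) - y (D.t i))) J']

variable [FiniteDimensional ℝ E] [BorelSpace E]

lemma memLp_of_isControl {u : ℝ → E} (hu : IsControl U r T u) :
    MemLp u (ENNReal.ofReal r) (volume.restrict (Icc 0 T)) :=
  ⟨hu.measurable.aestronglyMeasurable, hu.lrNorm_lt_top⟩

/-- Admissible processes have controls of finite norm. -/
lemma isControl_of_integrable (hT : 0 ≤ T)
    (hyp : ExistenceHypothesis f g U φ ψ T ξ r κ α β γ δ Cφ Cψ Cs Ce) {x u : ℝ → E}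
    (h : IsFeasible f g U T ξ x u) (hφ : IntegrableOn (fun t => φ t (x t) (u t)) (Icc 0 T)) :
    IsControl U r T u := by
  refine ⟨h.process.measurable, h.mem, ?_⟩
  have hr0 : 0 < r := by linarith [hyp.r_gt]
  obtain ⟨R, hR⟩ := isCompact_Icc.exists_bound_of_continuousOn (h.process.continuousOn hT)
  have hm := h.process.measurable.aestronglyMeasurable
  have hint : IntegrableOn (fun t => ‖u t‖ ^ r) (Icc 0 T) := by
    refine Integrable.mono' (g := fun t => φ t (x t) (u t) * Cφ⁻¹ + R ^ δ)
      ((hφ.mul_const _).add (integrableOn_const (by simp)))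
      (hm.norm.aemeasurable.pow_const r).aestronglyMeasurable ?_
    filter_upwards [h.mem, ae_restrict_mem measurableSet_Icc] with t ht1 ht2
    rw [Real.norm_of_nonneg (by positivity)]
    have h1 := hyp.coercive t ht2 (x t) (u t) ht1
    have h2 : ‖x t‖ ^ δ ≤ R ^ δ := Real.rpow_le_rpow (norm_nonneg _) (hR t ht2) hyp.delta_pos.le
    have h3 : ‖u t‖ ^ r - ‖x t‖ ^ δ ≤ φ t (x t) (u t) * Cφ⁻¹ := by
      rw [← div_eq_mul_inv, le_div_iff₀ hyp.Cphi_pos]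
      linarith
    linarith
  have : MemLp u (ENNReal.ofReal r) (volume.restrict (Icc 0 T)) := by
    rw [← integrable_norm_rpow_iff hm (by simpa using hr0) ENNReal.ofReal_ne_top,
      ENNReal.toReal_ofReal hr0.le]
    exact hint
  exact this.2

/-- The integral form of the state equation, and the a priori bounds on the state. -/
lemma process_bounds (hT : 0 < T)
    (hyp : ExistenceHypothesis f g U φ ψ T ξ r κ α β γ δ Cφ Cψ Cs Ce) {x u : ℝ → E}
    (hu : IsControl U r T u) (h : IsProcess f g T ξ x u) {M : ℝ} (hM : (lrNorm r T u).toReal ≤ M) :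
    (∀ s ∈ Icc 0 T, ∀ t ∈ Icc 0 T,
      x t - x s = ∫ τ in s..t, (f τ (x τ) + g τ (x τ) (u τ))) ∧
    HasSpeed r T (speedBound β Cs M ^ r) x (fun t => ‖deriv x t‖) ∧
    ∀ t ∈ Icc 0 T, ‖x t‖ ≤ stateBound γ Ce M := by
  have hr := hyp.r_gt
  have hN : 0 ≤ (lrNorm r T u).toReal := ENNReal.toReal_nonneg
  have hM0 : 0 ≤ M := hN.trans hM
  have hui := (norm_rpow_of_memLp hr (memLp_of_isControl hu)).1
  have hrhs := integrableOn_rhs hyp.continuous_f hyp.continuous_g (h.continuousOn hT.le) hui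
  have hode : ∀ s ∈ Icc 0 T, ∀ t ∈ Icc 0 T,
      x t - x s = ∫ τ in s..t, (f τ (x τ) + g τ (x τ) (u τ)) := fun s hs t ht =>
    sub_eq_intervalIntegral hT.le h.absolutelyContinuous hrhs h.state_eq hs ht
  have hder : deriv x =ᵐ[volume.restrict (Icc 0 T)] fun t => f t (x t) + g t (x t) (u t) := by
    filter_upwards [h.state_eq] with t ht using ht.deriv
  have hnl := hyp.nonlinearity u hu T hT le_rfl x h
  have hmem : MemLp (deriv x) (ENNReal.ofReal r) (volume.restrict (Icc 0 T)) :=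
    ⟨hrhs.aestronglyMeasurable.congr hder.symm, hnl.trans_lt ENNReal.ofReal_lt_top⟩
  obtain ⟨h1, h2, h3⟩ := norm_rpow_of_memLp hr hmem
  refine ⟨hode, ⟨fun t => norm_nonneg _, h1.norm, h2, ?_, ?_⟩, ?_⟩
  · rw [h3]
    have hCs := hyp.Cs_nonneg
    have hβ := hyp.beta_nonneg
    refine Real.rpow_le_rpow ENNReal.toReal_nonneg ?_ (by linarith)
    calc (lrNorm r T (deriv x)).toReal ≤ Cs * (1 + (lrNorm r T u).toReal ^ β) :=
          ENNReal.toReal_le_of_le_ofReal (by positivity) hnl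
      _ ≤ Cs * (1 + M ^ β) := by gcongr
      _ ≤ speedBound β Cs M := by unfold speedBound; linarith
  · intro s hs t ht hst
    have hsub : Ioc s t ⊆ Icc 0 T := fun τ hτ => ⟨hs.1.trans hτ.1.le, hτ.2.trans ht.2⟩
    rw [hode s hs t ht, intervalIntegral.integral_of_le hst]
    refine (norm_integral_le_integral_norm _).trans (le_of_eq (integral_congr_ae ?_))
    filter_upwards [ae_restrict_of_ae_restrict_of_subset hsub hder] with τ hτ
    rw [hτ]
  · intro t ht
    have hCe := hyp.Ce_nonneg
    have hγ := hyp.gamma_nonneg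
    refine (hyp.energy u hu T hT le_rfl x h t ht).trans ?_
    unfold stateBound
    gcongr

end Processes

/-! ### Compactness of processes. -/

section Compactness

variable {E : Type*} [NormedAddCommGroup E] [NormedSpace ℝ E] [FiniteDimensional ℝ E] {T r : ℝ}
  {f : ℝ → E → E} {g : ℝ → E → E →L[ℝ] E}

/-- Compactness: a subsequence of states with bounded speeds and of primitives of controls with
bounded norms converges, and the limits satisfy the state equation. -/
lemma exists_limit_process (hT : 0 < T) (hr : 1 < r)
    (hf : ContinuousOn (fun z : ℝ × E => f z.1 z.2) (Icc 0 T ×ˢ univ))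
    (hg : ContinuousOn (fun z : ℝ × E => g z.1 z.2) (Icc 0 T ×ˢ univ)) {x u : ℕ → ℝ → E}
    {v : ℕ → ℝ → ℝ} {B M R : ℝ} (hM : 0 < M) (hv : ∀ n, HasSpeed r T B (x n) (v n))
    (hx : ∀ n, ∀ t ∈ Icc 0 T, ‖x n t‖ ≤ R) (hu : ∀ n, IntegrableOn (u n) (Icc 0 T))
    (hur : ∀ n, IntegrableOn (fun t => ‖u n t‖ ^ r) (Icc 0 T))
    (huM : ∀ n, ∫ t in Icc 0 T, ‖u n t‖ ^ r ≤ M ^ r)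
    (hode : ∀ n, ∀ s ∈ Icc 0 T, ∀ t ∈ Icc 0 T,
      x n t - x n s = ∫ τ in s..t, (f τ (x n τ) + g τ (x n τ) (u n τ))) :
    ∃ (k : ℕ → ℕ) (z P : ℝ → E), StrictMono k ∧ Continuous z ∧
      TendstoUniformlyOn (fun n => x (k n)) z atTop (Icc 0 T) ∧
      (∀ t ∈ Icc 0 T, Tendsto (fun n => ∫ τ in (0 : ℝ)..t, u (k n) τ) atTop (𝓝 (P t))) ∧
      AbsolutelyContinuousOnInterval z 0 T ∧
      (∀ᵐ t ∂(volume.restrict (Icc 0 T)), DifferentiableAt ℝ P t) ∧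
      ∀ᵐ t ∂(volume.restrict (Icc 0 T)),
        HasDerivAt z (f t (z t) + g t (z t) (deriv P t)) t := by
  have h0 : (0 : ℝ) ∈ Icc 0 T := ⟨le_rfl, hT.le⟩
  let p : ℕ → ℝ → E := fun n t => ∫ τ in (0 : ℝ)..t, u n τ
  -- Carried along because `hasDerivAt_of_limit` needs the limit of these primitives to control its
  -- error.
  let q : ℕ → ℝ → ℝ := fun n t => ∫ τ in (0 : ℝ)..t, ‖u n τ‖
  have hp : ∀ n, HasSpeed r T (M ^ r) (p n) (fun t => ‖u n t‖) := fun n =>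
    ⟨fun t => norm_nonneg _, (hu n).norm, hur n, huM n, fun s hs t ht hst => by
      simp only [p]
      rw [← setIntegral_Ioc_eq_sub (hu n) hs ht hst]
      exact norm_integral_le_integral_norm _⟩
  have hq : ∀ n, HasSpeed r T (M ^ r) (q n) (fun t => ‖u n t‖) := fun n =>
    ⟨fun t => norm_nonneg _, (hu n).norm, hur n, huM n, fun s hs t ht hst => by
      simp only [q]
      rw [← setIntegral_Ioc_eq_sub (hu n).norm hs ht hst,
        Real.norm_of_nonneg (integral_nonneg fun t => norm_nonneg _)]⟩
  have hIoc : ∀ n, ∀ t ∈ Icc 0 T, ∫ τ in Ioc 0 t, ‖u n τ‖ ≤ (T + 1) * M := fun n t ht =>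
    (setIntegral_mono_set (hu n).norm (Eventually.of_forall fun t => norm_nonneg _)
      (Eventually.of_forall fun τ (hτ : τ ∈ Ioc 0 t) =>
        (⟨hτ.1.le, hτ.2.trans ht.2⟩ : τ ∈ Icc 0 T))).trans ((hp n).setIntegral_le hT.le hr hM)
  have hpb : ∀ n, ∀ t ∈ Icc 0 T, ‖p n t‖ ≤ (T + 1) * M := by
    intro n t ht
    have := ((hp n).le 0 h0 t ht ht.1).trans (hIoc n t ht)
    simpa [p] using this
  have hqb : ∀ n, ∀ t ∈ Icc 0 T, ‖q n t‖ ≤ (T + 1) * M := by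
    intro n t ht
    have := ((hq n).le 0 h0 t ht ht.1).trans (hIoc n t ht)
    simpa [q] using this
  obtain ⟨y, k, hy, hk, hlim⟩ := exists_subseq_tendstoUniformlyOn (F := E × E × ℝ) hT.le
    (z := fun n t => (x n t, p n t, q n t)) (R := max R (max ((T + 1) * M) ((T + 1) * M)))
    (fun n t ht => max_le_max (hx n t ht) (max_le_max (hpb n t ht) (hqb n t ht)))
    (by
      intro ε hε
      obtain ⟨δ₁, hδ₁, h1⟩ := exists_norm_sub_le (F := E) (T := T) hr B hε
      obtain ⟨δ₂, hδ₂, h2⟩ := exists_norm_sub_le (F := E) (T := T) hr (M ^ r) hε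
      obtain ⟨δ₃, hδ₃, h3⟩ := exists_norm_sub_le (F := ℝ) (T := T) hr (M ^ r) hε
      refine ⟨min δ₁ (min δ₂ δ₃), lt_min hδ₁ (lt_min hδ₂ hδ₃), fun n s hs t ht hst => ?_⟩
      have e1 := hst.trans (min_le_left _ _)
      have e2 := hst.trans ((min_le_right _ _).trans (min_le_left _ _))
      have e3 := hst.trans ((min_le_right _ _).trans (min_le_right _ _))
      exact max_le (h1 _ _ (hv n) s hs t ht e1)
        (max_le (h2 _ _ (hp n) s hs t ht e2) (h3 _ _ (hq n) s hs t ht e3)))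
  have hxz : TendstoUniformlyOn (fun n => x (k n)) (fun t => (y t).1) atTop (Icc 0 T) :=
    uniformContinuous_fst.comp_tendstoUniformlyOn hlim
  have hpz : ∀ t ∈ Icc 0 T, Tendsto (fun n => p (k n) t) atTop (𝓝 (y t).2.1) := fun t ht =>
    ((continuous_fst.comp continuous_snd).tendsto _).comp (hlim.tendsto_at ht)
  have hqz : ∀ t ∈ Icc 0 T, Tendsto (fun n => q (k n) t) atTop (𝓝 (y t).2.2) := fun t ht =>
    ((continuous_snd.comp continuous_snd).tendsto _).comp (hlim.tendsto_at ht)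
  have hzc : Continuous fun t => (y t).1 := continuous_fst.comp hy
  have hPac := absolutelyContinuousOnInterval_of_tendsto hT.le hr (fun n => hp (k n)) hpz
  have hPd : ∀ᵐ t ∂(volume.restrict (Icc 0 T)), DifferentiableAt ℝ (fun t => (y t).2.1) t := by
    have := hPac.boundedVariationOn.ae_differentiableAt_of_mem_uIcc
    rwa [uIcc_of_le hT.le, ← ae_restrict_iff' measurableSet_Icc] at this
  have hQac := absolutelyContinuousOnInterval_of_tendsto hT.le hr (fun n => hq (k n)) hqz
  have hQd : ∀ᵐ t ∂(volume.restrict (Icc 0 T)), DifferentiableAt ℝ (fun t => (y t).2.2) t := by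
    have := hQac.boundedVariationOn.ae_differentiableAt_of_mem_uIcc
    rwa [uIcc_of_le hT.le, ← ae_restrict_iff' measurableSet_Icc] at this
  refine ⟨k, fun t => (y t).1, fun t => (y t).2.1, hk, hzc, hxz, hpz,
    absolutelyContinuousOnInterval_of_tendsto hT.le hr (fun n => hv (k n))
      (fun t ht => hxz.tendsto_at ht), hPd, ?_⟩
  rw [← restrict_Ioo_eq_restrict_Icc] at hPd hQd ⊢
  filter_upwards [hPd, hQd, ae_restrict_mem measurableSet_Ioo] with t h1 h2 h3
  exact hasDerivAt_of_limit hT.le hf hg (fun n => (hv (k n)).continuousOn hr) (fun n => hu (k n))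
    (fun n => hode (k n)) hzc hxz hpz hqz h3 h1.hasDerivAt h2.hasDerivAt

end Compactness

/-! ### Young integrals along processes and coercivity of the cost. -/

section Existence

variable {E : Type*} [NormedAddCommGroup E] [NormedSpace ℝ E] [MeasurableSpace E] {d : ℕ} {T : ℝ}
  {f : ℝ → E → E} {g : ℝ → E → E →L[ℝ] E} {U : Set E}
  {φ : ℝ → E → E → ℝ} {ψ : ℝ → E → EuclideanSpace ℝ (Fin d) →L[ℝ] ℝ} {ξ : E}
  {r : ℝ} {κ : ℝ≥0} {α β γ δ Cφ Cψ Cs Ce : ℝ}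

/-- The strict inequality holds at a = 1/2 by hypothesis and persists slightly above by continuity.
The Young integral against a path of finite p-variation for all p > 2 needs a > 1/2. -/
lemma exists_exponent (hyp : ExistenceHypothesis f g U φ ψ T ξ r κ α β γ δ Cφ Cψ Cs Ce) :
    ∃ a : ℝ, 1 / 2 < a ∧ a < 1 ∧ a ≤ κ ∧ γ * α + γ * (κ - a) + β * a < r := by
  have h1 : Tendsto (fun a : ℝ => γ * α + γ * (κ - a) + β * a) (𝓝[>] (1 / 2))
      (𝓝 (γ * α + γ * (κ - 1 / 2) + β * (1 / 2))) :=
    (Continuous.tendsto (by fun_prop) _).mono_left nhdsWithin_le_nhds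
  have h2 : γ * α + γ * (κ - 1 / 2) + β * (1 / 2) < r := by linarith [hyp.exponent]
  have h3 : ∀ᶠ a : ℝ in 𝓝[>] (1 / 2), a < 1 := nhdsWithin_le_nhds (gt_mem_nhds (by norm_num))
  have h4 : ∀ᶠ a : ℝ in 𝓝[>] (1 / 2), a < κ := nhdsWithin_le_nhds (gt_mem_nhds hyp.kappa_gt)
  obtain ⟨a, ⟨⟨h5, h6⟩, h7⟩, h8⟩ :=
    (((h1.eventually (gt_mem_nhds h2)).and h3).and h4).and self_mem_nhdsWithin |>.exists
  exact ⟨a, h8, h6, h7.le, h5⟩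

/-- Young integrals of the observation function along states with bounded speed. -/
lemma exists_young_process (hT : 0 < T)
    (hyp : ExistenceHypothesis f g U φ ψ T ξ r κ α β γ δ Cφ Cψ Cs Ce)
    {η : ℝ → EuclideanSpace ℝ (Fin d)} (hη : IsObservationPath T η) {a : ℝ} (ha : 1 / 2 < a)
    (ha1 : a < 1) (haκ : a ≤ κ) :
    ∃ C, 0 ≤ C ∧ ∀ M, 0 ≤ M →
      (∀ (x : ℝ → E) (v : ℝ → ℝ), HasSpeed r T (speedBound β Cs M ^ r) x v →
        (∀ t ∈ Icc 0 T, ‖x t‖ ≤ stateBound γ Ce M) →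
        pVariation (1 / a) T (fun t => ψ t (x t)) < ⊤ ∧
        ∃ J, HasYoungIntegral T (fun t => ψ t (x t)) η J ∧
          |ψ 0 (x 0) (η T - η 0) - J| ≤ C * holderBound T κ a α β γ Cψ Cs Ce M) ∧
      ∀ ε > 0, ∃ ρ > 0, ∀ (x : ℝ → E) (v : ℝ → ℝ) (J : ℝ),
        HasSpeed r T (speedBound β Cs M ^ r) x v →
        (∀ t ∈ Icc 0 T, ‖x t‖ ≤ stateBound γ Ce M) →
        HasYoungIntegral T (fun t => ψ t (x t)) η J →
        ∀ D : Dissection T, (∀ i < D.n, D.t (i + 1) - D.t i < ρ) →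
          |youngSum D D.t (fun t => ψ t (x t)) η - J| ≤ ε := by
  set a' := (a + 1 / 2) / 2 with ha'
  set b := 3 / 4 - a' / 2 with hb
  have h1 : 1 / 2 < a' := by linarith
  have h2 : a' < a := by linarith
  have hb0 : 0 < b := by linarith
  have hp : 2 < 1 / b := by rw [lt_div_iff₀ hb0]; linarith
  have hab : 1 < a' + b := by linarith
  obtain ⟨w₀, hw₀, hη₀⟩ := exists_control (by linarith) (hη.pVariation_lt_top (1 / b) hp)
  rw [one_div_one_div] at hη₀
  obtain ⟨C, hC, hY⟩ := exists_hasYoungIntegral (W := ℝ) hT (by linarith) h2 hb0 hab hw₀ hη₀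
  refine ⟨C, hC, fun M hM => ⟨fun x v hv hx => ?_, fun ε hε => ?_⟩⟩
  · obtain ⟨w, hw, hwc, hw1, -, hψ⟩ :=
      exists_holder_control hT hyp (by linarith) haκ hM hv hx
    have hA := holderBound_nonneg hT hyp a hM
    refine ⟨pVariation_lt_top_of_control (by linarith) hA hw hψ, ?_⟩
    obtain ⟨J, hJ, hest⟩ := hY _ w _ hA hw hwc hw1 hψ
    refine ⟨J, hJ, ?_⟩
    -- The dissection with one interval, tagged at 0, has mesh at most 1 in the normalised control;
    -- its sum is `ψ 0 (x 0) (η T - η 0)`.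
    have h3 := hest (Dissection.uniform hT 0) (fun _ => 0) 1 one_pos
    have hn : (Dissection.uniform hT 0).n = 1 := rfl
    have ht0 : (Dissection.uniform hT 0).t 0 = 0 := (Dissection.uniform hT 0).zero
    have ht1 : (Dissection.uniform hT 0).t 1 = T := (Dissection.uniform hT 0).last
    simp only [hn, Nat.lt_one_iff, forall_eq, zero_add, ht0, ht1, youngSum, Finset.sum_range_one,
      Real.one_rpow, mul_one, left_mem_Icc, Real.norm_eq_abs] at h3
    exact h3 hw1 hT.le
  · have hA := holderBound_nonneg hT hyp a hM
    obtain ⟨μ, hμ, hμε⟩ : ∃ μ > 0,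
        C * holderBound T κ a α β γ Cψ Cs Ce M * μ ^ (a - a') < ε := by
      have h3 : Tendsto (fun μ : ℝ => C * holderBound T κ a α β γ Cψ Cs Ce M * μ ^ (a - a'))
          (𝓝[>] 0) (𝓝 (C * holderBound T κ a α β γ Cψ Cs Ce M * 0 ^ (a - a'))) :=
        ((Real.continuousAt_rpow_const 0 (a - a') (Or.inr (by linarith))).tendsto.const_mul
          _).mono_left nhdsWithin_le_nhds
      rw [Real.zero_rpow (by linarith), mul_zero] at h3
      obtain ⟨μ, h4, h5⟩ := ((h3.eventually (gt_mem_nhds hε)).and self_mem_nhdsWithin).exists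
      exact ⟨μ, h5, h4⟩
    -- Elapsed time and integrated speed each get T μ / 2, so dividing by T gives an increment of w
    -- of at most μ, uniformly over the states.
    obtain ⟨ρ, hρ, hρ'⟩ := exists_setIntegral_le (F := E) (T := T) hyp.r_gt
      (speedBound β Cs M ^ r) (show 0 < T * μ / 2 by positivity)
    refine ⟨min ρ (T * μ / 2), lt_min hρ (by positivity), fun x v J hv hx hJ D hD => ?_⟩
    obtain ⟨w, hw, hwc, hw1, hwm, hψ⟩ :=
      exists_holder_control hT hyp (by linarith) haκ hM hv hx
    obtain ⟨J', hJ', hest⟩ := hY _ w _ hA hw hwc hw1 hψ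
    rw [hJ.unique hT hJ', ← Real.norm_eq_abs]
    refine (hest D D.t μ hμ (fun i hi => ?_) fun i hi => ⟨le_rfl, (D.lt i hi).le⟩).trans hμε.le
    have hs := D.mem_Icc hi.le
    have ht := D.mem_Icc (i := i + 1) hi
    have hst := (D.lt i hi).le
    refine (hwm _ hs _ ht hst).trans ?_
    rw [div_le_iff₀ hT]
    have h3 := hD i hi
    have h4 := hρ' x v hv (Ioc (D.t i) (D.t (i + 1))) measurableSet_Ioc
      (fun τ hτ => ⟨hs.1.trans hτ.1.le, hτ.2.trans ht.2⟩) (by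
        rw [Real.volume_real_Ioc_of_le hst]
        exact h3.le.trans (min_le_left _ _))
    linarith [min_le_right ρ (T * μ / 2)]

/-- Convergence of the Young integrals along uniformly convergent states with bounded speed. -/
lemma tendsto_youngIntegral (hT : 0 < T)
    (hyp : ExistenceHypothesis f g U φ ψ T ξ r κ α β γ δ Cφ Cψ Cs Ce)
    {η : ℝ → EuclideanSpace ℝ (Fin d)} (hη : IsObservationPath T η) {M : ℝ} (hM : 0 ≤ M)
    {x : ℕ → ℝ → E} {v : ℕ → ℝ → ℝ}
    (hv : ∀ n, HasSpeed r T (speedBound β Cs M ^ r) (x n) (v n))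
    (hx : ∀ n, ∀ t ∈ Icc 0 T, ‖x n t‖ ≤ stateBound γ Ce M) {z : ℝ → E} {vz : ℝ → ℝ}
    (hvz : HasSpeed r T (speedBound β Cs M ^ r) z vz)
    (hz : ∀ t ∈ Icc 0 T, ‖z t‖ ≤ stateBound γ Ce M)
    (hxz : ∀ t ∈ Icc 0 T, Tendsto (fun n => x n t) atTop (𝓝 (z t))) {J : ℕ → ℝ} {Jz : ℝ}
    (hJ : ∀ n, HasYoungIntegral T (fun t => ψ t (x n t)) η (J n))
    (hJz : HasYoungIntegral T (fun t => ψ t (z t)) η Jz) : Tendsto J atTop (𝓝 Jz) := by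
  obtain ⟨a, ha, ha1, haκ, -⟩ := exists_exponent hyp
  obtain ⟨C, -, hC⟩ := exists_young_process hT hyp hη ha ha1 haκ
  have hCe := hyp.Ce_nonneg
  have hR : 0 ≤ stateBound γ Ce M := by unfold stateBound; positivity
  have hψ : ∀ t ∈ Icc 0 T, Tendsto (fun n => ψ t (x n t)) atTop (𝓝 (ψ t (z t))) := by
    intro t ht
    obtain ⟨K, -, hH⟩ := hyp.holder _ hR
    have hc := hH.continuousOn (by
      have := hyp.kappa_gt
      exact_mod_cast (by linarith : (0 : ℝ) < κ))
    refine (hc (t, z t) ⟨ht, hz t ht⟩).tendsto.comp (tendsto_nhdsWithin_iff.2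
      ⟨tendsto_const_nhds.prodMk_nhds (hxz t ht), Eventually.of_forall fun n => ⟨ht, hx n t ht⟩⟩)
  refine Metric.tendsto_nhds.2 fun ε hε => ?_
  obtain ⟨ρ, hρ, hS⟩ := (hC M hM).2 (ε / 4) (by positivity)
  obtain ⟨D, hD⟩ := Dissection.exists_mesh_lt hT hρ
  have hsum : Tendsto (fun n => youngSum D D.t (fun t => ψ t (x n t)) η) atTop
      (𝓝 (youngSum D D.t (fun t => ψ t (z t)) η)) := by
    refine tendsto_finsetSum _ fun i hi => ?_
    have hi := Finset.mem_range.1 hi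
    exact ((ContinuousLinearMap.apply ℝ ℝ (η (D.t (i + 1)) - η (D.t i))).continuous.tendsto _).comp
      (hψ _ (D.mem_Icc hi.le))
  filter_upwards [Metric.tendsto_nhds.1 hsum (ε / 4) (by positivity)] with n hn
  have e1 := hS _ _ _ (hv n) (hx n) (hJ n) D hD
  have e2 := hS _ _ _ hvz hz hJz D hD
  rw [Real.dist_eq] at hn ⊢
  rw [abs_le] at e1 e2
  rw [abs_lt] at hn ⊢
  constructor <;> linarith

variable [FiniteDimensional ℝ E] [BorelSpace E]

/-- Since `φ` is continuous only over `U` and [0, T], it is extended by zero to a Borel function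
before composition. -/
lemma aemeasurable_runningCost (hU : IsClosed U)
    (hφ : ContinuousOn (fun z : ℝ × E × E => φ z.1 z.2.1 z.2.2) (Icc 0 T ×ˢ (univ ×ˢ U)))
    {x u : ℝ → E} (hx : Continuous x) (hu : AEMeasurable u (volume.restrict (Icc 0 T)))
    (hmem : ∀ᵐ t ∂(volume.restrict (Icc 0 T)), u t ∈ U) :
    AEMeasurable (fun t => φ t (x t) (u t)) (volume.restrict (Icc 0 T)) := by
  classical
  have := FiniteDimensional.proper_real E
  have hS : MeasurableSet (Icc (0 : ℝ) T ×ˢ ((univ : Set E) ×ˢ U)) :=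
    measurableSet_Icc.prod (MeasurableSet.univ.prod hU.measurableSet)
  have h1 := hφ.measurable_piecewise (g := fun _ => (0 : ℝ)) continuousOn_const hS
  refine (h1.comp_aemeasurable (aemeasurable_id.prodMk (hx.aemeasurable.prodMk hu))).congr ?_
  filter_upwards [hmem, ae_restrict_mem measurableSet_Icc] with t ht1 ht2
  simp only [Function.comp_apply, id]
  exact piecewise_eq_of_mem _ _ _ (show (t, x t, u t) ∈ Icc (0 : ℝ) T ×ˢ ((univ : Set E) ×ˢ U) from
    ⟨ht2, mem_univ _, ht1⟩)

/-- The cost is defined on all admissible processes and controls the norm of the control. -/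
lemma exists_cost_bound (hT : 0 < T)
    (hyp : ExistenceHypothesis f g U φ ψ T ξ r κ α β γ δ Cφ Cψ Cs Ce)
    {η : ℝ → EuclideanSpace ℝ (Fin d)} (hη : IsObservationPath T η) :
    ∃ C, ∀ x u, IsAdmissible f g U φ ψ T ξ x u → (∃ c, HasCost φ ψ T η x u c) ∧
      ∀ c, HasCost φ ψ T η x u c → Cφ / 2 * (lrNorm r T u).toReal ^ r ≤ c + C := by
  obtain ⟨a, ha, ha1, haκ, hexp⟩ := exists_exponent hyp
  obtain ⟨C, hC0, hC⟩ := exists_young_process hT hyp hη ha ha1 haκ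
  have hr := hyp.r_gt
  have hr0 : 0 < r := by linarith
  have hCφ := hyp.Cphi_pos
  have hP1 := ((polyBound_holderBound (κ := (κ : ℝ)) hT.le (by linarith : (0 : ℝ) ≤ a) haκ
    hyp.alpha_nonneg hyp.beta_nonneg hyp.gamma_nonneg hyp.Cpsi_nonneg hyp.Cs_nonneg
    hyp.Ce_nonneg).const_mul hC0)
  have hP2 := ((polyBound_stateBound hyp.gamma_nonneg hyp.Ce_nonneg).rpow
    hyp.delta_pos.le).const_mul (mul_nonneg hCφ.le hT.le)
  -- The Young integral and the negative part of the coercivity bound each consume a quarter of Cφ N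
  -- ^ r, which leaves half.
  obtain ⟨C₁, hC₁⟩ := hP1.le_small hr0 hexp (ε := Cφ / 4) (by positivity)
  obtain ⟨C₂, hC₂⟩ := hP2.le_small hr0 hyp.exponent_delta (ε := Cφ / 4) (by positivity)
  refine ⟨C₁ + C₂ + |ψ 0 ξ (η T - η 0)|, fun x u h => ?_⟩
  have hu := isControl_of_integrable hT.le hyp h.feasible h.integrable
  set N := (lrNorm r T u).toReal
  have hN : 0 ≤ N := ENNReal.toReal_nonneg
  obtain ⟨-, hsp, hst⟩ := process_bounds hT hyp hu h.feasible.process le_rfl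
  obtain ⟨-, J, hJ, hJb⟩ := (hC N hN).1 x _ hsp hst
  refine ⟨⟨_, h.integrable, J, hJ, rfl⟩, ?_⟩
  rintro c ⟨-, J', hJ', rfl⟩
  rw [hJ'.unique hT hJ]
  rw [h.feasible.process.initial] at hJb
  have h1 := hC₁ N hN
  have h2 := hC₂ N hN
  obtain ⟨-, hui, huN⟩ := norm_rpow_of_memLp hr (memLp_of_isControl hu)
  have hint : Cφ * N ^ r - Cφ * T * stateBound γ Ce N ^ δ ≤ ∫ t in Icc 0 T, φ t (x t) (u t) := by
    have hconst : IntegrableOn (fun _ : ℝ => stateBound γ Ce N ^ δ) (Icc 0 T) :=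
      integrableOn_const (by simp)
    calc _ = ∫ t in Icc 0 T, Cφ * (‖u t‖ ^ r - stateBound γ Ce N ^ δ) := by
          rw [integral_const_mul, integral_sub hui hconst, huN, setIntegral_const,
            Real.volume_real_Icc_of_le hT.le, smul_eq_mul]
          ring
      _ ≤ _ := by
          refine integral_mono_ae ((hui.sub hconst).const_mul _) h.integrable ?_
          filter_upwards [hu.mem, ae_restrict_mem measurableSet_Icc] with t ht1 ht2
          refine le_trans ?_ (hyp.coercive t ht2 (x t) (u t) ht1)
          have := Real.rpow_le_rpow (norm_nonneg _) (hst t ht2) hyp.delta_pos.le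
          gcongr
  have h3 := (abs_le.1 hJb).2
  have h4 := neg_abs_le (ψ 0 ξ (η T - η 0))
  linarith

end Existence

/-! ### The minimising sequence and its limit. -/

section Minimiser

lemma lintegral_phi_add {T : ℝ} (hT : 0 ≤ T) {w : ℝ → ℝ} {C₀ : ℝ} (hw : IntegrableOn w (Icc 0 T))
    (h0 : ∀ᵐ t ∂(volume.restrict (Icc 0 T)), 0 ≤ w t + C₀) :
    ∫⁻ t in Icc 0 T, ENNReal.ofReal (w t + C₀) =
      ENNReal.ofReal ((∫ t in Icc 0 T, w t) + T * C₀) := by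
  have hc : IntegrableOn (fun _ : ℝ => C₀) (Icc 0 T) := integrableOn_const (by simp)
  refine (ofReal_integral_eq_lintegral_ofReal (hw.add hc) h0).symm.trans ?_
  congr 1
  have := integral_add hw hc
  rw [setIntegral_const, Real.volume_real_Icc_of_le hT, smul_eq_mul, sub_zero] at this
  exact this

variable {E : Type*} [NormedAddCommGroup E] [NormedSpace ℝ E] [MeasurableSpace E] {d : ℕ} {T : ℝ}
  {f : ℝ → E → E} {g : ℝ → E → E →L[ℝ] E} {U : Set E}
  {φ : ℝ → E → E → ℝ} {ψ : ℝ → E → EuclideanSpace ℝ (Fin d) →L[ℝ] ℝ} {ξ : E}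
  {r : ℝ} {κ : ℝ≥0} {α β γ δ Cφ Cψ Cs Ce : ℝ}

/-- A common shift that makes the running costs nonnegative along the sequence and along its limit,
so that Fatou's lemma can be used. -/
lemma le_phi_add (hyp : ExistenceHypothesis f g U φ ψ T ξ r κ α β γ δ Cφ Cψ Cs Ce) {x u : ℝ → E}
    {R : ℝ} (hx : ∀ t ∈ Icc 0 T, ‖x t‖ ≤ R)
    (hu : ∀ᵐ t ∂(volume.restrict (Icc 0 T)), u t ∈ U) :
    ∀ᵐ t ∂(volume.restrict (Icc 0 T)), 0 ≤ φ t (x t) (u t) + Cφ * R ^ δ := by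
  filter_upwards [hu, ae_restrict_mem measurableSet_Icc] with t ht1 ht2
  have h1 := hyp.coercive t ht2 (x t) (u t) ht1
  have h2 := mul_le_mul_of_nonneg_left
    (Real.rpow_le_rpow (norm_nonneg _) (hx t ht2) hyp.delta_pos.le) hyp.Cphi_pos.le
  have h3 : 0 ≤ Cφ * ‖u t‖ ^ r := mul_nonneg hyp.Cphi_pos.le (by positivity)
  linarith

variable [FiniteDimensional ℝ E] [BorelSpace E]

/-- Existence of a minimiser. -/
theorem exists_isMinimiser (hT : 0 < T)
    (hyp : ExistenceHypothesis f g U φ ψ T ξ r κ α β γ δ Cφ Cψ Cs Ce)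
    (hadm : ∃ x₀ u₀ : ℝ → E, IsAdmissible f g U φ ψ T ξ x₀ u₀)
    {η : ℝ → EuclideanSpace ℝ (Fin d)} (hη : IsObservationPath T η) :
    ∃ x u : ℝ → E, IsMinimiser f g U φ ψ T ξ η x u ∧ lrNorm r T u < ⊤ := by
  have hr := hyp.r_gt
  have hr0 : 0 < r := by linarith
  have hCφ := hyp.Cphi_pos
  have h0 : (0 : ℝ) ∈ Icc 0 T := ⟨le_rfl, hT.le⟩
  obtain ⟨C, hC⟩ := exists_cost_bound hT hyp hη
  set S : Set ℝ := {c | ∃ x u, IsAdmissible f g U φ ψ T ξ x u ∧ HasCost φ ψ T η x u c} with hS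
  have hSne : S.Nonempty := by
    obtain ⟨x, u, h⟩ := hadm
    obtain ⟨c, hc⟩ := (hC x u h).1
    exact ⟨c, x, u, h, hc⟩
  have hSb : BddBelow S := by
    refine ⟨-C, ?_⟩
    rintro c ⟨x, u, h, hc⟩
    have h1 := (hC x u h).2 c hc
    have h2 : 0 ≤ Cφ / 2 * (lrNorm r T u).toReal ^ r := by positivity
    linarith
  set m := sInf S
  obtain ⟨c, -, hcm, hcS⟩ := exists_seq_tendsto_sInf hSne hSb
  choose x u hxu hcost using hcS
  obtain ⟨c₁, hc₁⟩ := hcm.bddAbove_range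
  have hctl : ∀ n, IsControl U r T (u n) := fun n =>
    isControl_of_integrable hT.le hyp (hxu n).feasible (hxu n).integrable
  obtain ⟨M, hM, hMN⟩ : ∃ M : ℝ, 0 < M ∧ ∀ n, (lrNorm r T (u n)).toReal ≤ M := by
    refine ⟨(|2 / Cφ * (c₁ + C)|) ^ (1 / r) + 1, by positivity, fun n => ?_⟩
    have h1 := (hC _ _ (hxu n)).2 _ (hcost n)
    have h2 : c n ≤ c₁ := hc₁ (mem_range_self n)
    have h3 : (lrNorm r T (u n)).toReal ^ r ≤ |2 / Cφ * (c₁ + C)| := by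
      refine le_trans ?_ (le_abs_self _)
      rw [div_mul_eq_mul_div, le_div_iff₀ hCφ]
      linarith
    have h4 := Real.rpow_le_rpow (by positivity) h3 (show 0 ≤ 1 / r by positivity)
    rw [← Real.rpow_mul ENNReal.toReal_nonneg, mul_one_div_cancel hr0.ne', Real.rpow_one] at h4
    linarith
  have hbd := fun n => process_bounds hT hyp (hctl n) (hxu n).feasible.process (hMN n)
  have hun := fun n => norm_rpow_of_memLp hr (memLp_of_isControl (hctl n))
  obtain ⟨k, z, P, hk, hzc, hxz, hP, hzac, hPd, hzd⟩ := exists_limit_process hT hr hyp.continuous_f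
    hyp.continuous_g hM (fun n => (hbd n).2.1) (fun n => (hbd n).2.2) (fun n => (hun n).1)
    (fun n => (hun n).2.1)
    (fun n => (hun n).2.2.le.trans (Real.rpow_le_rpow ENNReal.toReal_nonneg (hMN n) hr0.le))
    (fun n => (hbd n).1)
  have := FiniteDimensional.complete ℝ E
  have hfeas : IsFeasible f g U T ξ z (deriv P) := by
    refine ⟨⟨(measurable_deriv P).aemeasurable, hzac, ?_, hzd⟩, ?_⟩
    · refine tendsto_nhds_unique (hxz.tendsto_at h0) ?_
      simp only [(hxu _).feasible.process.initial]
      exact tendsto_const_nhds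
    · rw [← restrict_Ioo_eq_restrict_Icc] at hPd ⊢
      filter_upwards [hPd, ae_restrict_mem measurableSet_Ioo] with t h1 h2
      exact mem_of_limit hyp.closed hyp.convex (fun n => (hun (k n)).1)
        (fun n => (hctl (k n)).mem) hP h2 h1.hasDerivAt
  -- Taken from the sequence: the energy estimate is not yet available for `z`, as its control is
  -- not yet known to have finite norm.
  have hzR : ∀ t ∈ Icc 0 T, ‖z t‖ ≤ stateBound γ Ce M := fun t ht =>
    le_of_tendsto (hxz.tendsto_at ht).norm (Eventually.of_forall fun n => (hbd (k n)).2.2 t ht)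
  set C₀ := Cφ * stateBound γ Ce M ^ δ
  have hlsc := lintegral_le_liminf_lintegral hyp.closed hyp.convex hyp.continuous_phi hyp.convex_phi
    hCφ hyp.delta_pos hr hyp.coercive (fun n => (hun (k n)).1) (fun n => (hctl (k n)).mem)
    (fun n => (hxu (k n)).integrable.aestronglyMeasurable.aemeasurable) hzc hxz hP hPd C₀
  have hpos := fun n => le_phi_add hyp (hbd (k n)).2.2 (hctl (k n)).mem
  have hΦ : ∀ n, ∫⁻ t in Icc 0 T, ENNReal.ofReal (φ t (x (k n) t) (u (k n) t) + C₀) =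
      ENNReal.ofReal ((∫ t in Icc 0 T, φ t (x (k n) t) (u (k n) t)) + T * C₀) := fun n =>
    lintegral_phi_add hT.le (hxu (k n)).integrable (hpos n)
  simp only [hΦ] at hlsc
  have hcost' := hcost
  choose hci J hJ hcJ using hcost'
  obtain ⟨a, ha, ha1, haκ, -⟩ := exists_exponent hyp
  obtain ⟨C₁, -, hC₁⟩ := exists_young_process hT hyp hη ha ha1 haκ
  have hJb : ∀ n, |ψ 0 ξ (η T - η 0) - J n| ≤ C₁ * holderBound T κ a α β γ Cψ Cs Ce M := by
    intro n
    obtain ⟨-, J', hJ', hb⟩ := (hC₁ M hM.le).1 _ _ (hbd n).2.1 (hbd n).2.2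
    rwa [(hJ n).unique hT hJ', ← (hxu n).feasible.process.initial]
  have hzmeas := aemeasurable_runningCost hyp.closed hyp.continuous_phi hzc
    hfeas.process.measurable hfeas.mem
  have hzpos := le_phi_add hyp hzR hfeas.mem
  have hzint : IntegrableOn (fun t => φ t (z t) (deriv P t)) (Icc 0 T) := by
    have h1 : IntegrableOn (fun t => φ t (z t) (deriv P t) + C₀) (Icc 0 T) := by
      refine ⟨(hzmeas.add_const C₀).aestronglyMeasurable, ?_⟩
      rw [hasFiniteIntegral_iff_ofReal hzpos]
      refine (hlsc.trans (liminf_le_of_frequently_le (Eventually.frequently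
        (Eventually.of_forall fun n => ENNReal.ofReal_le_ofReal (q := c₁ + |ψ 0 ξ (η T - η 0)| +
          C₁ * holderBound T κ a α β γ Cψ Cs Ce M + T * C₀) ?_)))).trans_lt ENNReal.ofReal_lt_top
      have h2 : c (k n) ≤ c₁ := hc₁ (mem_range_self _)
      have h3 := (abs_le.1 (hJb (k n))).2
      have h4 := neg_abs_le (ψ 0 ξ (η T - η 0))
      linarith [hcJ (k n)]
    have h2 : IntegrableOn (fun _ : ℝ => C₀) (Icc 0 T) := integrableOn_const (by simp)
    refine (h1.sub h2).congr (Eventually.of_forall fun t => ?_)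
    simp
  have hzctl := isControl_of_integrable hT.le hyp hfeas hzint
  -- No comparison of the limit control's norm with M is needed: one larger bound serves the
  -- sequence and the limit together.
  set M' := max M (lrNorm r T (deriv P)).toReal
  have hM' : 0 ≤ M' := hM.le.trans (le_max_left _ _)
  have hbd' := fun n => process_bounds hT hyp (hctl n) (hxu n).feasible.process
    ((hMN n).trans (le_max_left _ _ : M ≤ M'))
  obtain ⟨-, hz1, hz2⟩ := process_bounds hT hyp hzctl hfeas.process
    (le_max_right _ _ : (lrNorm r T (deriv P)).toReal ≤ M')
  obtain ⟨hzp, Jz, hJz, -⟩ := (hC₁ M' hM').1 _ _ hz1 hz2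
  have hzadm : IsAdmissible f g U φ ψ T ξ z (deriv P) :=
    ⟨hfeas, hzint, 1 / a, by rw [le_div_iff₀ (by linarith)]; linarith,
      by rw [div_lt_iff₀ (by linarith)]; linarith, hzp⟩
  have hJlim : Tendsto (fun n => J (k n)) atTop (𝓝 Jz) :=
    tendsto_youngIntegral hT hyp hη hM' (fun n => (hbd' (k n)).2.1) (fun n => (hbd' (k n)).2.2)
      hz1 hz2 (fun t ht => hxz.tendsto_at ht) (fun n => hJ (k n)) hJz
  have hφlim : Tendsto (fun n => (∫ t in Icc 0 T, φ t (x (k n) t) (u (k n) t)) + T * C₀) atTop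
      (𝓝 (m - Jz + T * C₀)) := by
    refine (((hcm.comp hk.tendsto_atTop).sub hJlim).add_const _).congr fun n => ?_
    simp only [Function.comp_apply]
    rw [hcJ (k n)]
    ring
  rw [(ENNReal.tendsto_ofReal hφlim).liminf_eq, lintegral_phi_add hT.le hzint hzpos] at hlsc
  have hTC : T * C₀ = ∫ t in Icc 0 T, C₀ := by
    rw [setIntegral_const, Real.volume_real_Icc_of_le hT.le, smul_eq_mul, sub_zero]
  -- Nonnegativity allows the inequality in `ℝ≥0∞` to be read back in the reals.
  have hlim0 : 0 ≤ m - Jz + T * C₀ := by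
    refine ge_of_tendsto hφlim (Eventually.of_forall fun n => ?_)
    rw [hTC, ← integral_add (hxu (k n)).integrable (integrableOn_const (by simp))]
    exact integral_nonneg_of_ae (hpos n)
  have hle : (∫ t in Icc 0 T, φ t (z t) (deriv P t)) + Jz ≤ m := by
    have := (ENNReal.ofReal_le_ofReal_iff hlim0).1 hlsc
    linarith
  refine ⟨z, deriv P, ⟨hzadm, _, ⟨hzint, Jz, hJz, rfl⟩, fun x' u' h' => ⟨(hC x' u' h').1, ?_⟩⟩,
    hzctl.lrNorm_lt_top⟩
  exact fun c' hc' => hle.trans (csInf_le hSb ⟨x', u', h', hc'⟩)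

end Minimiser

end VarDA

theorem theorem1 {E : Type*} [NormedAddCommGroup E] [NormedSpace ℝ E] [FiniteDimensional ℝ E]
    [MeasurableSpace E] [BorelSpace E] {d : ℕ} (T : ℝ) (hT : 0 < T)
    (f : ℝ → E → E) (g : ℝ → E → E →L[ℝ] E) (U : Set E)
    (φ : ℝ → E → E → ℝ) (ψ : ℝ → E → EuclideanSpace ℝ (Fin d) →L[ℝ] ℝ) (ξ : E)
    (r : ℝ) (κ : ℝ≥0) (α β γ δ Cφ Cψ Cs Ce : ℝ)
    (hyp : VarDA.ExistenceHypothesis f g U φ ψ T ξ r κ α β γ δ Cφ Cψ Cs Ce)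
    (hadm : ∃ x₀ u₀ : ℝ → E, VarDA.IsAdmissible f g U φ ψ T ξ x₀ u₀)
    (η : ℝ → EuclideanSpace ℝ (Fin d)) (hη : VarDA.IsObservationPath T η) :
    ∃ x u : ℝ → E, VarDA.IsMinimiser f g U φ ψ T ξ η x u ∧ VarDA.lrNorm r T u < ⊤ :=
  VarDA.exists_isMinimiser hT hyp hadm hη
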